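/- Let $n,m,p\ge 1$, $A_i\in\mathbb{R}^{p\times p}$, $B_i\in\mathbb{R}^{p\times m}$ ($i=1,\dots,n$), and consider the system in differential form $$y^{(n)}+A_1y^{(n-1)}+\cdots+A_ny=B_1u^{(n-1)}+\cdots+B_nu. \tag{1}$$ Assume that (1) is realized by a state-space system $\dot{\bar x}=\bar A\bar x+\bar Bu$, $y=\bar C\bar x$ with $\bar x\in\mathbb{R}^h$ (for every smooth input, each of its input-output trajectories satisfies (1)) that is reachable and observable, with $h=pn$ and $\mathrm{rank}\,\mathrm{col}(\bar C,\bar C\bar A,\dots,\bar C\bar A^{n-1})=h$. Let $\lambda(\cdot)$ denote the set of complex eigenvalues, and set $$A_{\mathrm M}=\begin{bmatrix}0_{p,p(n-1)}&-A_n\\ &\vdots\\ I_{p(n-1)}&-A_1\end{bmatrix},\quad B_{\mathrm M}=\begin{bmatrix}B_n\\ \vdots\\ B_1\end{bmatrix},\quad C_{\mathrm M}=[\,0_{p,p(n-1)}\ \ I_p\,],$$ where the last block column of $A_{\mathrm M}$ is $\mathrm{col}(-A_n,\dots,-A_1)$ and its first $p(n-1)$ columns are $\mathrm{col}(0_{p,p(n-1)},I_{p(n-1)})$.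 For $c_1,\dots,c_n\in\mathbb{R}$ let $A_{\mathrm r}\in\mathbb{R}^{n\times n}$ be the companion matrix with ones on the superdiagonal, last row $[-c_n\ \cdots\ -c_1]$, and zeros elsewhere, and let $B_{\mathrm r}=\mathrm{col}(0,\dots,0,1)\in\mathbb{R}^{n}$. Let $\beta\in\mathbb{R}$ and $T_S>0$ be such that * $-\beta\notin\lambda(A_{\mathrm r})$ and $\lambda(A_{\mathrm M})\cap\lambda(A_{\mathrm r})=\emptyset$; * with $S=\{-\beta\}\cup\lambda(A_{\mathrm M})\cup\lambda(A_{\mathrm r})$, there are no $\ell\in S$ and $k\in\mathbb{Z}\setminus\{0\}$ with $\ell+\imath\,2k\pi T_S^{-1}\in S$. Let $N\in\mathbb N$ and $d_0,\dots,d_{N-1}\in\mathbb{R}^m$, and apply the input $u(t)=d_k$ for $t\in[kT_S,(k+1)T_S)$, $k=0,\dots,N-1$, to the interconnection $$\begin{aligned}\dot x&=A_{\mathrm M}x+B_{\mathrm M}u,\quad y=C_{\mathrm M}x,\quad x(0)\in\mathbb{R}^{pn}\ \text{arbitrary},\\ \dot\zeta&=(A_{\mathrm r}\otimes I_m)\zeta+(B_{\mathrm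 r}\otimes I_m)u,\quad \zeta(0)=0,\\ \dot\mu&=(A_{\mathrm r}\otimes I_p)\mu+(B_{\mathrm r}\otimes I_p)y,\quad \mu(0)=0,\\ \dot\phi&=-\beta\phi+\mathrm{col}(\zeta,\mu),\quad \phi(0)=0,\qquad \dot\upsilon=-\beta\upsilon+u,\quad \upsilon(0)=0,\end{aligned}$$ on $[0,NT_S]$. Let $\Phi_N=[\phi(T_S)\ \cdots\ \phi(NT_S)]$ and $\Upsilon_N=[\upsilon(T_S)\ \cdots\ \upsilon(NT_S)]$. Write $(z-\mathrm e^{-\beta T_S})\det(zI_n-\mathrm e^{A_{\mathrm r}^\top T_S})=w_0z^{n+1}+w_1z^n+\cdots+w_{n+1}$, let $W_N\in\mathbb{R}^{N\times(N-n-1)}$ be the lower triangular Toeplitz matrix whose first column is $[w_{n+1}\ \cdots\ w_1\ w_0\ 0\ \cdots\ 0]^\top$, and put $\bar\Phi_N=\Phi_NW_N$, $\bar\Upsilon_N=\Upsilon_NW_N$. If the sequence $d_1,\dots,d_{N-1}$ is persistently exciting of order $L=2((m+p)n+m)$, i.e. its Hankel matrix of depth $L$ (with $L$ block rows) has rank $Lm$,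 then $$\mathrm{rank}\begin{bmatrix}\bar\Phi_N\\ \bar\Upsilon_N\end{bmatrix}=(m+p)n+m .$$ -/

import Mathlib

open scoped Matrix Kronecker ContDiff

noncomputable section

namespace MIMOExcitation

/-- The spectrum of a real square matrix, as a set of complex numbers. -/
def cspec {ι : Type*} [Fintype ι] [DecidableEq ι] (M : Matrix ι ι ℝ) : Set ℂ :=
  spectrum ℂ (M.map (algebraMap ℝ ℂ))

/-! ### The plant

Coefficients are numbered from zero: for a family `A : Fin n → _`, the term `A i` is the
coefficient written `A_{i+1}` in the usual notation; `A i.rev` is then `A_{n-i}`. -/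

/-- The differential equation
`y^(n) + A_1 y^(n-1) + ⋯ + A_n y = B_1 u^(n-1) + ⋯ + B_n u` at time `t`. -/
def DiffEqAt {n m p : ℕ} (A : Fin n → Matrix (Fin p) (Fin p) ℝ)
    (B : Fin n → Matrix (Fin p) (Fin m) ℝ) (u : ℝ → Fin m → ℝ) (y : ℝ → Fin p → ℝ)
    (t : ℝ) : Prop :=
  iteratedDeriv n y t + ∑ i : Fin n, A i *ᵥ iteratedDeriv (n - (i + 1)) y t
    = ∑ i : Fin n, B i *ᵥ iteratedDeriv (n - (i + 1)) u t

/-- The state space system `x' = Abar x + Bbar u`, `y = Cbar x` realizes the differential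
equation with coefficients `A`, `B`: for every smooth input and every state trajectory, the
resulting input-output pair satisfies the differential equation. -/
def IsRealization {n m p h : ℕ} (Abar : Matrix (Fin h) (Fin h) ℝ)
    (Bbar : Matrix (Fin h) (Fin m) ℝ) (Cbar : Matrix (Fin p) (Fin h) ℝ)
    (A : Fin n → Matrix (Fin p) (Fin p) ℝ) (B : Fin n → Matrix (Fin p) (Fin m) ℝ) : Prop :=
  ∀ (u : ℝ → Fin m → ℝ) (x : ℝ → Fin h → ℝ), ContDiff ℝ ∞ u →
    (∀ t, HasDerivAt x (Abar *ᵥ x t + Bbar *ᵥ u t) t) →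
    ∀ t, DiffEqAt A B u (fun s => Cbar *ᵥ x s) t

/-- `[B, A B, …, A^(k-1) B]`. -/
def reachMatrix {h m : ℕ} (k : ℕ) (A : Matrix (Fin h) (Fin h) ℝ)
    (B : Matrix (Fin h) (Fin m) ℝ) : Matrix (Fin h) (Fin k × Fin m) ℝ :=
  Matrix.of fun i j => (A ^ (j.1 : ℕ) * B) i j.2

/-- `col(C, C A, …, C A^(k-1))`. -/
def obsMatrix {h p : ℕ} (k : ℕ) (A : Matrix (Fin h) (Fin h) ℝ)
    (C : Matrix (Fin p) (Fin h) ℝ) : Matrix (Fin k × Fin p) (Fin h) ℝ :=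
  Matrix.of fun i j => (C * A ^ (i.1 : ℕ)) i.2 j

/-- The pair `(A, B)` is reachable. -/
def Reachable {h m : ℕ} (A : Matrix (Fin h) (Fin h) ℝ) (B : Matrix (Fin h) (Fin m) ℝ) : Prop :=
  (reachMatrix h A B).rank = h

/-- The pair `(A, C)` is observable. -/
def Observable {h p : ℕ} (A : Matrix (Fin h) (Fin h) ℝ) (C : Matrix (Fin p) (Fin h) ℝ) : Prop :=
  (obsMatrix h A C).rank = h

/-- The standing assumption on the plant: reachability, observability, `p n = h`, and the first
`n` blocks of the observability matrix already have rank `h`. -/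
structure PlantAssumption {m p h : ℕ} (n : ℕ) (Abar : Matrix (Fin h) (Fin h) ℝ)
    (Bbar : Matrix (Fin h) (Fin m) ℝ) (Cbar : Matrix (Fin p) (Fin h) ℝ) : Prop where
  reachable : Reachable Abar Bbar
  observable : Observable Abar Cbar
  dim : p * n = h
  rank_obs : (obsMatrix n Abar Cbar).rank = h

/-- Block companion matrix: identities below the block diagonal and last block column
`col(-A_n, …, -A_1)`. -/
def AM {n p : ℕ} (A : Fin n → Matrix (Fin p) (Fin p) ℝ) :
    Matrix (Fin n × Fin p) (Fin n × Fin p) ℝ :=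
  Matrix.of fun i j =>
    if (j.1 : ℕ) + 1 = n then -(A i.1.rev i.2 j.2)
    else if (i.1 : ℕ) = j.1 + 1 ∧ i.2 = j.2 then 1 else 0

/-- `col(B_n, …, B_1)`. -/
def BM {n m p : ℕ} (B : Fin n → Matrix (Fin p) (Fin m) ℝ) :
    Matrix (Fin n × Fin p) (Fin m) ℝ :=
  Matrix.of fun i j => B i.1.rev i.2 j

/-- `[0 I_p]`. -/
def CM (n p : ℕ) : Matrix (Fin p) (Fin n × Fin p) ℝ :=
  Matrix.of fun i j => if (j.1 : ℕ) + 1 = n ∧ i = j.2 then 1 else 0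

/-! ### The filters -/

/-- Companion matrix with ones above the diagonal and last row `[-c_n ⋯ -c_1]`. -/
def Ar {n : ℕ} (c : Fin n → ℝ) : Matrix (Fin n) (Fin n) ℝ :=
  Matrix.of fun i j =>
    if (i : ℕ) + 1 = n then -(c j.rev) else if (j : ℕ) = i + 1 then 1 else 0

/-- The column `col(0, …, 0, 1)`. -/
def Br (n : ℕ) : Matrix (Fin n) (Fin 1) ℝ :=
  Matrix.of fun i _ => if (i : ℕ) + 1 = n then 1 else 0

/-- `A_r ⊗ I_q`. -/
def ArKron {n : ℕ} (c : Fin n → ℝ) (q : ℕ) : Matrix (Fin n × Fin q) (Fin n × Fin q) ℝ :=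
  Ar c ⊗ₖ (1 : Matrix (Fin q) (Fin q) ℝ)

/-- `B_r ⊗ I_q`, the column index set `Fin 1 × Fin q` being identified with `Fin q`. -/
def BrKron (n q : ℕ) : Matrix (Fin n × Fin q) (Fin q) ℝ :=
  (Br n ⊗ₖ (1 : Matrix (Fin q) (Fin q) ℝ)).submatrix id (fun a => ((0 : Fin 1), a))

/-- `x` solves `x' = f(t)` on `[0, T]`: it is continuous on `[0, T]` and has right derivative `f t`
at every `t ∈ [0, T)`. This is the usual notion of solution when, as here, the right-hand
side is right-continuous with finitely many jumps. -/
def SolvesOn {ι : Type*} [Fintype ι] (T : ℝ) (x f : ℝ → ι → ℝ) : Prop :=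
  ContinuousOn x (Set.Icc 0 T) ∧
    ∀ t ∈ Set.Ico 0 T, HasDerivWithinAt x (f t) (Set.Ici t) t

/-- `chi = col(zeta, mu)`. -/
def chi {n m p : ℕ} (zeta : ℝ → Fin n × Fin m → ℝ) (mu : ℝ → Fin n × Fin p → ℝ) (t : ℝ) :
    (Fin n × Fin m) ⊕ (Fin n × Fin p) → ℝ :=
  Sum.elim (zeta t) (mu t)

/-- Trajectories on `[0, T]`, under the input `u`, of the interconnection of the plant
`x' = A_M x + B_M u`, `y = C_M x` (with arbitrary initial state) and the filters, which start
from zero. -/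
structure IsInterconnection {n m p : ℕ} (A : Fin n → Matrix (Fin p) (Fin p) ℝ)
    (B : Fin n → Matrix (Fin p) (Fin m) ℝ) (c : Fin n → ℝ) (β T : ℝ) (u : ℝ → Fin m → ℝ)
    (x : ℝ → Fin n × Fin p → ℝ) (zeta : ℝ → Fin n × Fin m → ℝ) (mu : ℝ → Fin n × Fin p → ℝ)
    (phi : ℝ → (Fin n × Fin m) ⊕ (Fin n × Fin p) → ℝ) (upsilon : ℝ → Fin m → ℝ) : Prop where
  plant : SolvesOn T x fun t => AM A *ᵥ x t + BM B *ᵥ u t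
  zeta_eq : SolvesOn T zeta fun t => ArKron c m *ᵥ zeta t + BrKron n m *ᵥ u t
  mu_eq : SolvesOn T mu fun t => ArKron c p *ᵥ mu t + BrKron n p *ᵥ (CM n p *ᵥ x t)
  phi_eq : SolvesOn T phi fun t => -β • phi t + chi zeta mu t
  upsilon_eq : SolvesOn T upsilon fun t => -β • upsilon t + u t
  zeta_zero : zeta 0 = 0
  mu_zero : mu 0 = 0
  phi_zero : phi 0 = 0
  upsilon_zero : upsilon 0 = 0

/-! ### Sampled data -/

/-- The data matrix `[f(TS) f(2 TS) ⋯ f(N TS)]`. -/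
def dataMatrix {ι : Type*} (N : ℕ) (TS : ℝ) (f : ℝ → ι → ℝ) : Matrix ι (Fin N) ℝ :=
  Matrix.of fun i k => f (((k : ℕ) + 1 : ℝ) * TS) i

/-- `(z - e^(-β TS)) det(z I - e^(A_rᵀ TS))`. -/
def firPoly {n : ℕ} (c : Fin n → ℝ) (β TS : ℝ) : Polynomial ℝ :=
  (Polynomial.X - Polynomial.C (Real.exp (-β * TS))) *
    (NormedSpace.exp (TS • (Ar c)ᵀ)).charpoly

/-- The coefficients of `firPoly = w_0 z^(n+1) + w_1 z^n + ⋯ + w_(n+1)`. -/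
def firCoeff {n : ℕ} (c : Fin n → ℝ) (β TS : ℝ) (i : ℕ) : ℝ :=
  (firPoly c β TS).coeff (n + 1 - i)

/-- The `N × (N - n - 1)` lower triangular Toeplitz matrix with first column
`col(w_(n+1), …, w_1, w_0, 0, …, 0)`. -/
def WN {n : ℕ} (c : Fin n → ℝ) (β TS : ℝ) (N : ℕ) : Matrix (Fin N) (Fin (N - n - 1)) ℝ :=
  Matrix.of fun i j =>
    if (j : ℕ) ≤ i ∧ (i : ℕ) - j ≤ n + 1 then firCoeff c β TS (n + 1 - ((i : ℕ) - j)) else 0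

/-- The Hankel matrix of depth `L` of the finite sequence `s 0, …, s (len - 1)`: its `j`-th column
is `col(s j, …, s (j + L - 1))`. -/
def hankel {m : ℕ} (L len : ℕ) (s : ℕ → Fin m → ℝ) :
    Matrix (Fin L × Fin m) (Fin (len + 1 - L)) ℝ :=
  Matrix.of fun i j => s ((i.1 : ℕ) + j) i.2

/-- The finite sequence `s 0, …, s (len - 1)` in `ℝ^m` is persistently exciting of order `L`. -/
def PersistentlyExciting {m : ℕ} (L len : ℕ) (s : ℕ → Fin m → ℝ) : Prop :=
  (hankel L len s).rank = L * m

/-- The sampling time `TS` is non-pathological for the set `S` of modes: no two elements of `S`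
differ by a nonzero integer multiple of `2 π i / TS`. -/
def NonPathological (TS : ℝ) (S : Set ℂ) : Prop :=
  ¬ ∃ l ∈ S, ∃ k : ℤ, k ≠ 0 ∧ l + Complex.I * (2 * (k : ℂ) * (Real.pi : ℂ) * (TS : ℂ)⁻¹) ∈ S

end MIMOExcitation

end

/-!
The interconnection of plant and filters is one linear system with state
`X = (x, col(ζ, μ), (φ, υ))` and block lower triangular state matrix, so that the samples satisfy
`X (k + 1) = F X k + Γ d k` with `F` the exponential of the sampled state matrix. Suppose that a
row vector `v` annihilates the filtered data matrix. Then the sequence `v ⬝ (φ, υ)(k TS)`,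
`k ≥ 1`, satisfies the difference equation whose polynomial is that of the FIR filter, hence also
its multiple by the characteristic polynomial of `exp (TS A_M)`. This multiple annihilates `F`
(`aeval_exp_stateMatrix_eq_zero`), so the initial condition drops out of the equation and what
remains is a linear relation among `n (p + 1) + 1 ≤ L` consecutive inputs. By persistency of
excitation all its coefficients vanish, which means that the discrete-time impulse response
`v F ^ k Γ` is zero (`vecMul_pow_mul_eq_zero_of_excitation`).

Non-pathological sampling carries this over to continuous time. If no two eigenvalues of `M`
differ by a nonzero multiple of `2πi`, then `exp M - exp l` is, for each eigenvalue `l`, the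
product of `M - l` and a unit; comparing degrees of annihilating polynomials, `M` is a polynomial
in `exp M` (`mem_adjoin_exp`). This is applied to the state matrix augmented by the held input, an
additional state with zero derivative; the additional eigenvalue `0` is harmless because the set
of modes is closed under conjugation (`NonPathological.insert_zero`).

Finally, let the continuous-time impulse response of `v (φ, υ)` be zero; impulse responses are
represented by their sequences of derivatives at time `0`, the Markov parameters. Its initial
value is the `υ` part of `v`, and removing the filter `1 / (s + β)` leaves a linear relation among
the impulse responses of `ζ` and `μ`. Applying the characteristic polynomial of the filters, as a
difference operator on these sequences (`companionOp`), kills `ζ` and turns `μ` into the shifted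
Markov parameters of the plant, so the coefficients `α` of `μ` satisfy
`∑ i, α_i C A ^ (i + j) B = 0` for all `j`, in terms of the minimal realization (which has the
same Markov parameters as `A_M`, `B_M`, `C_M`: `IsRealization.markov_eq`). Reachability and the
rank of the observability matrix give `α = 0`, and then the coefficients of `ζ` vanish by
triangularity (`eq_zero_of_vecMul_filter_response`).
-/

namespace MIMOExcitation

/-! ### Intertwined and block triangular matrices -/

section Intertwining

open Matrix Polynomial
open scoped Matrix.Norms.Operator

variable {K : Type*} [Field K] {ι κ : Type*} [Fintype ι] [DecidableEq ι] [Fintype κ]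
  [DecidableEq κ]

theorem mul_pow_of_intertwine {J : Matrix κ ι K} {M : Matrix ι ι K} {N : Matrix κ κ K}
    (h : J * M = N * J) (k : ℕ) : J * M ^ k = N ^ k * J := by
  induction k with
  | zero => simp
  | succ k ih => rw [pow_succ, ← Matrix.mul_assoc, ih, Matrix.mul_assoc, h, ← Matrix.mul_assoc,
      ← pow_succ]

theorem mul_aeval_of_intertwine {J : Matrix κ ι K} {M : Matrix ι ι K} {N : Matrix κ κ K}
    (h : J * M = N * J) (p : K[X]) : J * aeval M p = aeval N p * J := by
  simp only [aeval_eq_sum_range, Matrix.mul_sum, Matrix.sum_mul, Matrix.mul_smul, Matrix.smul_mul,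
    mul_pow_of_intertwine h]

theorem mul_exp_of_intertwine {J : Matrix κ ι ℝ} {M : Matrix ι ι ℝ} {N : Matrix κ κ ℝ}
    (h : J * M = N * J) : J * NormedSpace.exp M = NormedSpace.exp N * J := by
  have h1 := (NormedSpace.exp_series_hasSum_exp' (𝕂 := ℝ) M).map
    (AddMonoidHom.mk' (fun X : Matrix ι ι ℝ => J * X) (Matrix.mul_add J))
    (by exact continuous_const.matrix_mul continuous_id)
  have h2 := (NormedSpace.exp_series_hasSum_exp' (𝕂 := ℝ) N).map
    (AddMonoidHom.mk' (fun X : Matrix κ κ ℝ => X * J) (fun X Y => Matrix.add_mul X Y J))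
    (by exact continuous_id.matrix_mul continuous_const)
  refine h1.unique (h2.congr_fun ?_)
  intro k
  simp [Matrix.mul_smul, Matrix.smul_mul, mul_pow_of_intertwine h]

omit [DecidableEq ι] [DecidableEq κ] in
theorem smul_intertwine {J : Matrix κ ι K} {M : Matrix ι ι K} {N : Matrix κ κ K}
    (h : J * M = N * J) (t : K) : J * (t • M) = (t • N) * J := by
  rw [Matrix.mul_smul, Matrix.smul_mul, h]

/-- The intertwining relations with `[1 0]` and `col(0, 1)` say that a matrix is block lower
triangular, and determine its diagonal blocks. -/
theorem eq_fromBlocks_lower {E : Matrix (ι ⊕ κ) (ι ⊕ κ) K} {a : Matrix ι ι K} {d : Matrix κ κ K}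
    (h1 : fromCols (1 : Matrix ι ι K) (0 : Matrix ι κ K) * E
      = a * fromCols (1 : Matrix ι ι K) (0 : Matrix ι κ K))
    (h2 : fromRows (0 : Matrix ι κ K) (1 : Matrix κ κ K) * d
      = E * fromRows (0 : Matrix ι κ K) (1 : Matrix κ κ K)) :
    E = fromBlocks a 0 E.toBlocks₂₁ d := by
  rw [← fromBlocks_toBlocks E] at h1 h2
  rw [fromCols_mul_fromBlocks, mul_fromCols] at h1
  rw [fromBlocks_mul_fromRows, fromRows_mul] at h2
  obtain ⟨h11, h12⟩ := fromCols_inj h1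
  obtain ⟨-, h22⟩ := fromRows_inj h2
  conv_lhs => rw [← fromBlocks_toBlocks E]
  simp at h11 h12 h22
  rw [h11, h12, ← h22]

omit [DecidableEq κ] in
theorem fromCols_intertwine_lower (A : Matrix ι ι K) (C : Matrix κ ι K) (D : Matrix κ κ K) :
    fromCols (1 : Matrix ι ι K) (0 : Matrix ι κ K) * fromBlocks A 0 C D
      = A * fromCols (1 : Matrix ι ι K) (0 : Matrix ι κ K) := by
  rw [fromCols_mul_fromBlocks, mul_fromCols]
  simp

omit [DecidableEq ι] in
theorem fromRows_intertwine_lower (A : Matrix ι ι K) (C : Matrix κ ι K) (D : Matrix κ κ K) :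
    fromRows (0 : Matrix ι κ K) (1 : Matrix κ κ K) * D
      = fromBlocks A 0 C D * fromRows (0 : Matrix ι κ K) (1 : Matrix κ κ K) := by
  rw [fromBlocks_mul_fromRows, fromRows_mul]
  simp

theorem exists_aeval_fromBlocks_lower (A : Matrix ι ι K) (C : Matrix κ ι K) (D : Matrix κ κ K)
    (p : K[X]) :
    ∃ Y, aeval (fromBlocks A 0 C D) p = fromBlocks (aeval A p) 0 Y (aeval D p) :=
  ⟨_, eq_fromBlocks_lower (mul_aeval_of_intertwine (fromCols_intertwine_lower A C D) p)
    (mul_aeval_of_intertwine (fromRows_intertwine_lower A C D) p)⟩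

theorem exists_exp_fromBlocks_lower (A : Matrix ι ι ℝ) (C : Matrix κ ι ℝ) (D : Matrix κ κ ℝ)
    (t : ℝ) :
    ∃ Y, NormedSpace.exp (t • fromBlocks A 0 C D)
      = fromBlocks (NormedSpace.exp (t • A)) 0 Y (NormedSpace.exp (t • D)) :=
  ⟨_, eq_fromBlocks_lower
    (mul_exp_of_intertwine (smul_intertwine (fromCols_intertwine_lower A C D) t))
    (mul_exp_of_intertwine (smul_intertwine (fromRows_intertwine_lower A C D) t))⟩

/-- A product of polynomials annihilating the diagonal blocks annihilates a block triangular
matrix. -/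
theorem aeval_mul_fromBlocks_lower_eq_zero {A : Matrix ι ι K} (C : Matrix κ ι K)
    {D : Matrix κ κ K} {p q : K[X]} (hp : aeval A p = 0) (hq : aeval D q = 0) :
    aeval (fromBlocks A 0 C D) (p * q) = 0 := by
  obtain ⟨Y, hY⟩ := exists_aeval_fromBlocks_lower A C D p
  obtain ⟨Z, hZ⟩ := exists_aeval_fromBlocks_lower A C D q
  rw [mul_comm p q, map_mul, hY, hZ, hp, hq, fromBlocks_multiply]
  simp

end Intertwining

/-! ### Recovering a matrix from its sampled exponential -/

section Sampling

open Matrix Polynomial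
open scoped Matrix.Norms.Operator

variable {ι : Type*} [Fintype ι] [DecidableEq ι]

theorem mem_spectrum_of_mulVec_eq {M : Matrix ι ι ℂ} {w : ι → ℂ} {l : ℂ} (hw : w ≠ 0)
    (h : M *ᵥ w = l • w) : l ∈ spectrum ℂ M := by
  rw [← Matrix.spectrum_toLin', ← Module.End.hasEigenvalue_iff_mem_spectrum]
  exact Module.End.hasEigenvalue_of_hasEigenvector (x := w)
    ⟨Module.End.mem_eigenspace_iff.mpr (by simpa using h), hw⟩

/-- A singular matrix commuting with `M` annihilates an eigenvector of `M`. -/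
theorem exists_eigenvector_of_commute {M G : Matrix ι ι ℂ} (h : Commute M G)
    (hG : ¬ IsUnit G) : ∃ l : ℂ, ∃ w ≠ 0, M *ᵥ w = l • w ∧ G *ᵥ w = 0 := by
  obtain ⟨v, hv, hGv⟩ : ∃ v ≠ 0, G *ᵥ v = 0 := by
    rw [Matrix.exists_mulVec_eq_zero_iff]
    rw [Matrix.isUnit_iff_isUnit_det, isUnit_iff_ne_zero] at hG
    simpa using hG
  let W : Submodule ℂ (ι → ℂ) := LinearMap.ker G.toLin'
  have hW : ∀ w ∈ W, M.toLin' w ∈ W := by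
    intro w hw
    simp only [W, LinearMap.mem_ker, Matrix.toLin'_apply] at hw ⊢
    rw [Matrix.mulVec_mulVec, ← h.eq, ← Matrix.mulVec_mulVec, hw, Matrix.mulVec_zero]
  have : Nontrivial W := ⟨⟨⟨v, by simpa [W] using hGv⟩, 0, fun e => hv (congrArg Subtype.val e)⟩⟩
  obtain ⟨l, hl⟩ := Module.End.exists_eigenvalue (M.toLin'.restrict hW)
  obtain ⟨w, hw⟩ := hl.exists_hasEigenvector
  refine ⟨l, w, fun e => hw.2 (Subtype.ext e), ?_, ?_⟩
  · simpa using congrArg Subtype.val hw.apply_eq_smul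
  · have := w.2
    rwa [LinearMap.mem_ker, Matrix.toLin'_apply] at this

omit [DecidableEq ι] in
theorem mulVec_of_hasSum {f : ℕ → Matrix ι ι ℂ} {S : Matrix ι ι ℂ} (h : HasSum f S) (w : ι → ℂ) :
    HasSum (fun k => f k *ᵥ w) (S *ᵥ w) :=
  h.map (AddMonoidHom.mk' (fun X : Matrix ι ι ℂ => X *ᵥ w) (fun X Y => Matrix.add_mulVec X Y w))
    (by exact continuous_id.matrix_mulVec continuous_const)

theorem pow_mulVec_of_eigen {M : Matrix ι ι ℂ} {w : ι → ℂ} {l : ℂ} (h : M *ᵥ w = l • w) (k : ℕ) :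
    M ^ k *ᵥ w = l ^ k • w := by
  induction k with
  | zero => simp
  | succ k ih => rw [pow_succ, ← Matrix.mulVec_mulVec, h, Matrix.mulVec_smul, ih, smul_smul,
      pow_succ, mul_comm]

theorem exp_mulVec_of_eigen {M : Matrix ι ι ℂ} {w : ι → ℂ} {l : ℂ} (h : M *ᵥ w = l • w) :
    NormedSpace.exp M *ᵥ w = Complex.exp l • w := by
  have h1 := mulVec_of_hasSum (NormedSpace.exp_series_hasSum_exp' (𝕂 := ℂ) M) w
  have h2 := (NormedSpace.exp_series_hasSum_exp' (𝕂 := ℂ) l).smul_const w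
  rw [← Complex.exp_eq_exp_ℂ] at h2
  refine h1.unique ?_
  convert h2 using 1
  funext k
  rw [Matrix.smul_mulVec, pow_mulVec_of_eigen h, smul_smul, smul_eq_mul]

/-- If no nonzero multiple of `2πi` is an eigenvalue of `M`, then `exp M - 1` is `M` times a
unit. -/
theorem exists_exp_sub_one_eq_mul {M : Matrix ι ι ℂ}
    (h : ∀ k : ℤ, k ≠ 0 → (k : ℂ) * (2 * Real.pi * Complex.I) ∉ spectrum ℂ M) :
    ∃ G : Matrix ι ι ℂ, IsUnit G ∧ Commute M G ∧ NormedSpace.exp M - 1 = M * G := by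
  have hexp := NormedSpace.exp_series_hasSum_exp' (𝕂 := ℂ) M
  -- `G = ∑ Mᵏ / (k + 1)!`
  have hsum : Summable fun k : ℕ => ((k + 1).factorial : ℂ)⁻¹ • M ^ k := by
    refine Summable.of_norm_bounded
      (NormedSpace.norm_expSeries_summable' (𝕂 := ℂ) M) fun k => ?_
    rw [norm_smul, norm_smul]
    gcongr
    simp only [norm_inv, Complex.norm_natCast]
    gcongr
    omega
  obtain ⟨G, hG⟩ := hsum
  have hcomm : Commute M G := by
    have h1 := hG.mul_left M
    have h2 := hG.mul_right M
    refine h1.unique ?_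
    convert h2 using 1
    funext k
    rw [Matrix.mul_smul, Matrix.smul_mul, ← pow_succ, ← pow_succ']
  have hMG : NormedSpace.exp M - 1 = M * G := by
    have h1 := hG.mul_left M
    have h2 := (hasSum_nat_add_iff' 1).mpr hexp
    simp only [Finset.range_one, Finset.sum_singleton, Nat.factorial_zero, Nat.cast_one, inv_one,
      pow_zero, one_smul] at h2
    refine h2.unique (h1.congr_fun fun k => ?_)
    rw [Matrix.mul_smul, ← pow_succ']
  refine ⟨G, ?_, hcomm, hMG⟩
  by_contra hGu
  obtain ⟨l, w, hw, hMw, hGw⟩ := exists_eigenvector_of_commute hcomm hGu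
  have h1 : (Complex.exp l - 1) • w = 0 := by
    have h2 : (NormedSpace.exp M - 1) *ᵥ w = 0 := by
      rw [hMG, ← Matrix.mulVec_mulVec, hGw, Matrix.mulVec_zero]
    rw [Matrix.sub_mulVec, exp_mulVec_of_eigen hMw, Matrix.one_mulVec] at h2
    rw [sub_smul, one_smul, h2]
  have hl1 : Complex.exp l = 1 := by
    rcases smul_eq_zero.mp h1 with h2 | h2
    · exact sub_eq_zero.mp h2
    · exact absurd h2 hw
  obtain ⟨k, hk⟩ := Complex.exp_eq_one_iff.mp hl1
  by_cases hk0 : k = 0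
  · -- the eigenvalue `0` of `M` gives the eigenvalue `1` of `G`
    have hl0 : l = 0 := by simpa [hk0] using hk
    have h3 := mulVec_of_hasSum hG w
    have h4 : HasSum (fun k : ℕ => (((k + 1).factorial : ℂ)⁻¹ • M ^ k) *ᵥ w) w := by
      have := hasSum_single (f := fun k : ℕ => (((k + 1).factorial : ℂ)⁻¹ • M ^ k) *ᵥ w) 0 (by
        intro j hj
        rw [Matrix.smul_mulVec, pow_mulVec_of_eigen hMw, hl0, zero_pow hj]
        simp)
      simpa using this
    exact hw ((h4.unique h3).trans hGw)
  · exact h k hk0 (hk ▸ mem_spectrum_of_mulVec_eq hw hMw)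

/-- The spectrum of `M` does not alias under `exp`: no two eigenvalues differ by a nonzero multiple
of `2πi`. For `M = T • M'` this is `NonPathological T` for the spectrum of `M'`. -/
def NoAliasing (M : Matrix ι ι ℂ) : Prop :=
  ∀ l ∈ spectrum ℂ M, ∀ k : ℤ, k ≠ 0 → l + (k : ℂ) * (2 * Real.pi * Complex.I) ∉ spectrum ℂ M

/-- The factor `z ↦ exp z - exp l` vanishes on the spectrum of `M` only at `l`, to first order. -/
theorem exists_exp_sub_eq_mul {M : Matrix ι ι ℂ} (h : NoAliasing M) {l : ℂ}
    (hl : l ∈ spectrum ℂ M) :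
    ∃ G : Matrix ι ι ℂ, IsUnit G ∧ Commute M G ∧
      NormedSpace.exp M - algebraMap ℂ _ (Complex.exp l) = (M - algebraMap ℂ _ l) * G := by
  obtain ⟨G, hG, hc, he⟩ := exists_exp_sub_one_eq_mul (M := M - algebraMap ℂ _ l) (by
    intro k hk hmem
    refine h l hl k hk ?_
    rw [add_comm, spectrum.add_mem_iff]
    rwa [sub_eq_neg_add] at hmem)
  have hcM : Commute M G := by
    have := hc.add_left (Algebra.commutes l G : Commute (algebraMap ℂ _ l) G)
    simpa using this
  have hexp : NormedSpace.exp M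
      = algebraMap ℂ _ (Complex.exp l) * NormedSpace.exp (M - algebraMap ℂ _ l) := by
    have hadd := NormedSpace.exp_add_of_commute
      (Algebra.commutes l (M - algebraMap ℂ _ l) : Commute (algebraMap ℂ _ l) _)
    rw [Complex.exp_eq_exp_ℂ, NormedSpace.algebraMap_exp_comm]
    rw [add_sub_cancel] at hadd
    exact hadd
  refine ⟨algebraMap ℂ _ (Complex.exp l) * G, ?_, ?_, ?_⟩
  · exact ((isUnit_iff_ne_zero.mpr (Complex.exp_ne_zero l)).map (algebraMap ℂ _)).mul hG
  · exact Commute.mul_right (Algebra.commutes _ _ : Commute (algebraMap ℂ _ _) M).symm hcM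
  · rw [hexp, ← mul_assoc, ← Algebra.commutes (Complex.exp l) (M - algebraMap ℂ _ l), mul_assoc,
      ← he, mul_sub, mul_one]

theorem exists_exp_eq_of_mem_spectrum_exp {M : Matrix ι ι ℂ} {ν : ℂ}
    (hν : ν ∈ spectrum ℂ (NormedSpace.exp M)) : ∃ l ∈ spectrum ℂ M, Complex.exp l = ν := by
  obtain ⟨l, w, hw, hMw, hGw⟩ := exists_eigenvector_of_commute
    (M := M) (G := algebraMap ℂ _ ν - NormedSpace.exp M)
    (Commute.sub_right (Algebra.commutes _ _ : Commute (algebraMap ℂ _ _) M).symm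
      (Commute.refl M).exp_right) hν
  refine ⟨l, mem_spectrum_of_mulVec_eq hw hMw, ?_⟩
  rw [Matrix.sub_mulVec, exp_mulVec_of_eigen hMw, Algebra.algebraMap_eq_smul_one,
    Matrix.smul_mulVec, Matrix.one_mulVec, ← sub_smul] at hGw
  rcases smul_eq_zero.mp hGw with h | h
  · exact (sub_eq_zero.mp h).symm
  · exact absurd h hw

/-- A polynomial in `exp M` with roots among the eigenvalues of `exp M` is a polynomial of the
same degree in `M`, up to a unit. -/
theorem exists_aeval_exp_eq_mul {M : Matrix ι ι ℂ} (h : NoAliasing M) (s : Multiset ℂ)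
    (hs : ∀ ν ∈ s, ν ∈ spectrum ℂ (NormedSpace.exp M)) :
    ∃ q : ℂ[X], q.Monic ∧ q.natDegree = s.card ∧ ∃ G : Matrix ι ι ℂ, IsUnit G ∧ Commute M G ∧
      aeval (NormedSpace.exp M) (s.map fun ν => X - C ν).prod = aeval M q * G := by
  induction s using Multiset.induction_on with
  | empty => exact ⟨1, monic_one, by simp, 1, isUnit_one, Commute.one_right M, by simp⟩
  | cons ν s ih =>
    obtain ⟨q, hq, hdeg, G, hG, hc, he⟩ := ih fun ν hν => hs ν (Multiset.mem_cons_of_mem hν)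
    obtain ⟨l, hl, rfl⟩ := exists_exp_eq_of_mem_spectrum_exp (hs ν (Multiset.mem_cons_self ν s))
    obtain ⟨H, hH, hcH, heH⟩ := exists_exp_sub_eq_mul h hl
    refine ⟨(X - C l) * q, (monic_X_sub_C l).mul hq, ?_, H * G, hH.mul hG, hcH.mul_right hc, ?_⟩
    · rw [(monic_X_sub_C l).natDegree_mul hq, hdeg]
      simp [add_comm]
    · have hcq : Commute (aeval M q) H := by
        have := Polynomial.aeval_eq_sum_range (p := q) M
        rw [this]
        exact Commute.sum_left _ _ _ fun i _ => (hcH.pow_left i).smul_left _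
      rw [Multiset.map_cons, Multiset.prod_cons, map_mul, he, map_mul]
      simp only [map_sub, aeval_X, aeval_C]
      rw [heH, mul_assoc, mul_assoc, ← mul_assoc H, ← hcq.eq, mul_assoc]

theorem exp_mem_adjoin (M : Matrix ι ι ℂ) :
    NormedSpace.exp M ∈ Algebra.adjoin ℂ {M} := by
  refine NormedSpace.exp_mem (R := ℂ) (s := Algebra.adjoin ℂ {M}) ?_
    (Algebra.self_mem_adjoin_singleton ℂ M)
  exact (Subalgebra.toSubmodule (Algebra.adjoin ℂ {M})).closed_of_finiteDimensional

/-- Without aliasing, a matrix is a polynomial in its exponential: the two generate algebras of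
the same dimension. -/
theorem mem_adjoin_exp {M : Matrix ι ι ℂ} (h : NoAliasing M) :
    M ∈ Algebra.adjoin ℂ {NormedSpace.exp M} := by
  set E := NormedSpace.exp M with hE
  set p := minpoly ℂ E with hp
  have hint : IsIntegral ℂ E := Algebra.IsIntegral.isIntegral E
  have hsplit : (p.roots.map fun ν => X - C ν).prod = p := by
    have := (IsAlgClosed.splits p).eq_prod_roots_of_monic (minpoly.monic hint)
    exact this.symm
  obtain ⟨q, hq, hdeg, G, hG, hc, he⟩ := exists_aeval_exp_eq_mul h p.roots (by
    intro ν hν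
    have hroot := (mem_roots'.mp hν).2
    rw [← Matrix.spectrum_toLin', ← Module.End.hasEigenvalue_iff_mem_spectrum]
    refine Module.End.hasEigenvalue_of_isRoot ?_
    rwa [Matrix.minpoly_toLin'])
  have hqM : aeval M q = 0 := by
    rw [hsplit, minpoly.aeval] at he
    exact (hG.mul_left_eq_zero).mp he.symm
  have hdeg' : q.natDegree = p.natDegree := by
    rw [hdeg, ← (IsAlgClosed.splits p).natDegree_eq_card_roots]
  have hle : Subalgebra.toSubmodule (Algebra.adjoin ℂ {E})
      ≤ Subalgebra.toSubmodule (Algebra.adjoin ℂ {M}) := by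
    refine Subalgebra.toSubmodule.monotone (Algebra.adjoin_le ?_)
    simpa using exp_mem_adjoin M
  have hup : Module.finrank ℂ (Subalgebra.toSubmodule (Algebra.adjoin ℂ {M})) ≤ p.natDegree := by
    have hspan : Subalgebra.toSubmodule (Algebra.adjoin ℂ {M})
        ≤ Submodule.span ℂ (Set.range fun i : Fin q.natDegree => M ^ (i : ℕ)) := by
      intro Y hY
      rw [Subalgebra.mem_toSubmodule, Algebra.adjoin_singleton_eq_range_aeval] at hY
      obtain ⟨f, rfl⟩ := hY
      have hf : aeval M f = aeval M (f %ₘ q) := (aeval_modByMonic_eq_self_of_root hqM).symm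
      rw [AlgHom.toRingHom_eq_coe, RingHom.coe_coe, hf]
      rcases eq_or_ne q 1 with h1 | h1
      · simp [h1]
      rw [aeval_eq_sum_range' (natDegree_modByMonic_lt f hq h1)]
      refine Submodule.sum_mem _ fun i hi => Submodule.smul_mem _ _ (Submodule.subset_span ?_)
      exact ⟨⟨i, Finset.mem_range.mp hi⟩, rfl⟩
    calc _ ≤ _ := Submodule.finrank_mono hspan
      _ ≤ Fintype.card (Fin q.natDegree) := finrank_range_le_card _
      _ = p.natDegree := by simp [hdeg']
  have hlow : p.natDegree ≤ Module.finrank ℂ (Subalgebra.toSubmodule (Algebra.adjoin ℂ {E})) := by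
    have hli := linearIndependent_pow (K := ℂ) E
    have h1 := finrank_span_eq_card hli
    rw [Fintype.card_fin] at h1
    rw [hp, ← h1]
    refine Submodule.finrank_mono (Submodule.span_le.mpr ?_)
    rintro _ ⟨i, rfl⟩
    exact Subalgebra.pow_mem _ (Algebra.self_mem_adjoin_singleton ℂ E) _
  have heq := Submodule.eq_of_le_of_finrank_le hle (hup.trans hlow)
  have hM : M ∈ Subalgebra.toSubmodule (Algebra.adjoin ℂ {M}) :=
    Algebra.self_mem_adjoin_singleton ℂ M
  rw [← heq] at hM
  exact hM

/-- Without pathological sampling, a discrete-time impulse response vanishes only if the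
continuous-time one does. -/
theorem dotProduct_pow_mulVec_eq_zero_of_sampled {M : Matrix ι ι ℝ} {T : ℝ} (hT : T ≠ 0)
    (hM : NonPathological T (cspec M)) (g b : ι → ℝ)
    (h : ∀ j : ℕ, g ⬝ᵥ (NormedSpace.exp (T • M) ^ j *ᵥ b) = 0) (j : ℕ) :
    g ⬝ᵥ (M ^ j *ᵥ b) = 0 := by
  set F : Matrix ι ι ℝ →+* Matrix ι ι ℂ := (algebraMap ℝ ℂ).mapMatrix with hF
  have hFc : Continuous F := continuous_id.matrix_map Complex.continuous_ofReal
  have hTC : (T : ℂ) ≠ 0 := by exact_mod_cast hT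
  have hFT : F (T • M) = (T : ℂ) • F M := by
    ext a c
    simp [hF]
  have hexp : F (NormedSpace.exp (T • M)) = NormedSpace.exp ((T : ℂ) • F M) := by
    rw [← hFT]
    exact NormedSpace.map_exp F hFc (T • M)
  have hna : NoAliasing ((T : ℂ) • F M) := by
    have hmem : ∀ z : ℂ, z ∈ spectrum ℂ ((T : ℂ) • F M) ↔ (T : ℂ)⁻¹ * z ∈ cspec M := by
      intro z
      have := spectrum.smul_mem_smul_iff (R := ℂ) (a := F M) (s := (T : ℂ)⁻¹ * z)
        (r := Units.mk0 (T : ℂ) hTC)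
      rw [show cspec M = spectrum ℂ (F M) from rfl, ← this]
      simp [Units.smul_def, hTC]
    intro l hl k hk hlk
    rw [hmem] at hl hlk
    refine hM ⟨_, hl, k, hk, ?_⟩
    convert hlk using 1
    ring
  have hmem := mem_adjoin_exp hna
  rw [← hexp] at hmem
  have hmem' : F M ∈ Algebra.adjoin ℂ {F (NormedSpace.exp (T • M))} := by
    have := Subalgebra.smul_mem _ hmem (T : ℂ)⁻¹
    rwa [smul_smul, inv_mul_cancel₀ hTC, one_smul] at this
  have hcast : ∀ Y : Matrix ι ι ℝ, (fun i => (g i : ℂ)) ⬝ᵥ (F Y *ᵥ fun i => (b i : ℂ))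
      = ((g ⬝ᵥ (Y *ᵥ b) : ℝ) : ℂ) := by
    intro Y
    simp [hF, dotProduct, mulVec]
  have hpow := Subalgebra.pow_mem _ hmem' j
  rw [Algebra.adjoin_singleton_eq_range_aeval] at hpow
  obtain ⟨f, hf⟩ := hpow
  rw [AlgHom.toRingHom_eq_coe, RingHom.coe_coe, aeval_eq_sum_range] at hf
  have h0 : (fun i => (g i : ℂ)) ⬝ᵥ (F (M ^ j) *ᵥ fun i => (b i : ℂ)) = 0 := by
    rw [map_pow, ← hf, Matrix.sum_mulVec, dotProduct_sum]
    refine Finset.sum_eq_zero fun i _ => ?_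
    rw [Matrix.smul_mulVec, dotProduct_smul, ← map_pow, hcast, h]
    simp
  rw [hcast] at h0
  exact_mod_cast h0

end Sampling

/-! ### Sampling a linear differential equation with piecewise constant input -/

section LinearODE

open Matrix
open scoped Matrix.Norms.Operator

variable {ι κ : Type*} [Fintype ι] [DecidableEq ι] [Fintype κ] [DecidableEq κ]

theorem hasDerivAt_exp_smul_entry (G : Matrix ι ι ℝ) (t : ℝ) (i j : ι) :
    HasDerivAt (fun s : ℝ => NormedSpace.exp (s • G) i j)
      ((NormedSpace.exp (t • G) * G) i j) t := by
  have h := hasDerivAt_exp_smul_const (𝕂 := ℝ) G t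
  exact ((Matrix.entryLinearMap ℝ ℝ i j).toContinuousLinearMap.hasFDerivAt).comp_hasDerivAt t h

omit [DecidableEq ι] [Fintype κ] [DecidableEq κ] in
theorem hasDerivWithinAt_mulVec [Finite κ] {E : ℝ → Matrix κ ι ℝ} {E' : Matrix κ ι ℝ}
    {v : ℝ → ι → ℝ} {v' : ι → ℝ} {s : Set ℝ} {t : ℝ}
    (hE : ∀ i j, HasDerivWithinAt (fun r => E r i j) (E' i j) s t)
    (hv : HasDerivWithinAt v v' s t) :
    HasDerivWithinAt (fun r => E r *ᵥ v r) (E' *ᵥ v t + E t *ᵥ v') s t := by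
  have := Fintype.ofFinite κ
  rw [hasDerivWithinAt_pi] at hv ⊢
  intro i
  have h := HasDerivWithinAt.fun_sum (u := Finset.univ) fun j _ => (hE i j).mul (hv j)
  simpa [mulVec, dotProduct, Finset.sum_add_distrib] using h

/-- A trajectory of a homogeneous linear equation is given by the matrix exponential: the
derivative of `exp ((b - t) G) V(t)` vanishes. -/
theorem eq_exp_mulVec_of_hasDerivWithinAt {G : Matrix ι ι ℝ} {V : ℝ → ι → ℝ} {a b : ℝ}
    (hab : a ≤ b) (hc : ContinuousOn V (Set.Icc a b))
    (hd : ∀ t ∈ Set.Ico a b, HasDerivWithinAt V (G *ᵥ V t) (Set.Ici t) t) :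
    V b = NormedSpace.exp ((b - a) • G) *ᵥ V a := by
  have hE : ∀ t i j, HasDerivAt (fun s : ℝ => NormedSpace.exp ((b - s) • G) i j)
      ((-(NormedSpace.exp ((b - t) • G) * G)) i j) t := by
    intro t i j
    have h := (hasDerivAt_exp_smul_entry G (b - t) i j).comp t ((hasDerivAt_id t).const_sub b)
    simpa using! h
  have hEc : Continuous fun s : ℝ => NormedSpace.exp ((b - s) • G) :=
    continuous_pi fun i => continuous_pi fun j =>
      continuous_iff_continuousAt.mpr fun t => (hE t i j).continuousAt
  have hcont : ContinuousOn (fun s => NormedSpace.exp ((b - s) • G) *ᵥ V s) (Set.Icc a b) := by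
    refine continuousOn_pi.mpr fun i => ?_
    simp only [mulVec, dotProduct]
    refine continuousOn_finsetSum _ fun j _ => ContinuousOn.mul ?_ (continuousOn_pi.mp hc j)
    exact fun t _ => (hE t i j).continuousAt.continuousWithinAt
  have hconst := constant_of_has_deriv_right_zero hcont (fun t ht => by
    have h := hasDerivWithinAt_mulVec (fun i j => (hE t i j).hasDerivWithinAt) (hd t ht)
    rwa [neg_mulVec, ← mulVec_mulVec, neg_add_cancel] at h) b ⟨hab, le_rfl⟩
  simpa using hconst

/-- One sampling step of `x' = A x + B u`, for an input that is constant on the step. The input is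
treated as an additional state with zero derivative. -/
theorem SolvesOn.sample {S a b : ℝ} {A : Matrix ι ι ℝ} {B : Matrix ι κ ℝ} {u : ℝ → κ → ℝ}
    {x : ℝ → ι → ℝ} (hx : SolvesOn S x fun t => A *ᵥ x t + B *ᵥ u t)
    (ha : 0 ≤ a) (hab : a ≤ b) (hb : b ≤ S) {d : κ → ℝ} (hu : ∀ t ∈ Set.Ico a b, u t = d) :
    Sum.elim d (x b) = NormedSpace.exp ((b - a) • fromBlocks 0 0 B A) *ᵥ Sum.elim d (x a) := by
  refine eq_exp_mulVec_of_hasDerivWithinAt (V := fun t => Sum.elim d (x t)) hab ?_ ?_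
  · refine continuousOn_pi.mpr ?_
    rintro (i | i)
    · exact continuousOn_const
    · exact continuousOn_pi.mp (hx.1.mono (Set.Icc_subset_Icc ha hb)) i
  · intro t ht
    have h := hasDerivWithinAt_pi.mp (hx.2 t ⟨ha.trans ht.1, ht.2.trans_le hb⟩)
    rw [hasDerivWithinAt_pi]
    rintro (i | i)
    · simpa [fromBlocks_mulVec] using! hasDerivWithinAt_const t (Set.Ici t) (d i)
    · simpa [fromBlocks_mulVec, hu t ht, add_comm] using! h i

end LinearODE

/-! ### The interconnection as one linear system -/

section Interconnection

open Matrix Polynomial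
open scoped Matrix.Norms.Operator

variable {n m p : ℕ}

/-- Index set of the state `(x, col(ζ, μ), (φ, υ))` of the interconnection. -/
abbrev StateIdx (n m p : ℕ) : Type :=
  (Fin n × Fin p) ⊕ (((Fin n × Fin m) ⊕ (Fin n × Fin p)) ⊕
    (((Fin n × Fin m) ⊕ (Fin n × Fin p)) ⊕ Fin m))

/-- State matrix of the filters `col(ζ, μ)`. -/
def filterMatrix (m p : ℕ) (c : Fin n → ℝ) :
    Matrix ((Fin n × Fin m) ⊕ (Fin n × Fin p)) ((Fin n × Fin m) ⊕ (Fin n × Fin p)) ℝ :=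
  fromBlocks (ArKron c m) 0 0 (ArKron c p)

/-- State matrix of the interconnection; it is block lower triangular. -/
def stateMatrix (m : ℕ) (A : Fin n → Matrix (Fin p) (Fin p) ℝ) (c : Fin n → ℝ) (β : ℝ) :
    Matrix (StateIdx n m p) (StateIdx n m p) ℝ :=
  fromBlocks (AM A) 0 (fromRows (fromRows 0 (BrKron n p * CM n p)) 0)
    (fromBlocks (filterMatrix m p c) 0 (fromRows 1 0) (-β • 1))

/-- Input matrix of the interconnection. -/
def inputMatrix (B : Fin n → Matrix (Fin p) (Fin m) ℝ) : Matrix (StateIdx n m p) (Fin m) ℝ :=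
  fromRows (BM B) (fromRows (fromRows (BrKron n m) 0) (fromRows 0 1))

/-- State matrix of the interconnection with the (piecewise constant) input as leading states. -/
def augMatrix (A : Fin n → Matrix (Fin p) (Fin p) ℝ) (B : Fin n → Matrix (Fin p) (Fin m) ℝ)
    (c : Fin n → ℝ) (β : ℝ) : Matrix (Fin m ⊕ StateIdx n m p) (Fin m ⊕ StateIdx n m p) ℝ :=
  fromBlocks 0 0 (inputMatrix B) (stateMatrix m A c β)

/-- State of the interconnection. -/
def stateVec (x : ℝ → Fin n × Fin p → ℝ) (zeta : ℝ → Fin n × Fin m → ℝ)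
    (mu : ℝ → Fin n × Fin p → ℝ) (phi : ℝ → (Fin n × Fin m) ⊕ (Fin n × Fin p) → ℝ)
    (upsilon : ℝ → Fin m → ℝ) (t : ℝ) : StateIdx n m p → ℝ :=
  Sum.elim (x t) (Sum.elim (chi zeta mu t) (Sum.elim (phi t) (upsilon t)))

theorem SolvesOn.sumElim {ι κ : Type*} [Fintype ι] [Fintype κ] {T : ℝ} {x f : ℝ → ι → ℝ}
    {y g : ℝ → κ → ℝ} (hx : SolvesOn T x f) (hy : SolvesOn T y g) :
    SolvesOn T (fun t => Sum.elim (x t) (y t)) (fun t => Sum.elim (f t) (g t)) := by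
  refine ⟨continuousOn_pi.mpr ?_, fun t ht => hasDerivWithinAt_pi.mpr ?_⟩
  · rintro (i | i)
    · exact continuousOn_pi.mp hx.1 i
    · exact continuousOn_pi.mp hy.1 i
  · rintro (i | i)
    · exact hasDerivWithinAt_pi.mp (hx.2 t ht) i
    · exact hasDerivWithinAt_pi.mp (hy.2 t ht) i

theorem IsInterconnection.solvesOn {A : Fin n → Matrix (Fin p) (Fin p) ℝ}
    {B : Fin n → Matrix (Fin p) (Fin m) ℝ} {c : Fin n → ℝ} {β T : ℝ} {u : ℝ → Fin m → ℝ}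
    {x : ℝ → Fin n × Fin p → ℝ} {zeta : ℝ → Fin n × Fin m → ℝ} {mu : ℝ → Fin n × Fin p → ℝ}
    {phi : ℝ → (Fin n × Fin m) ⊕ (Fin n × Fin p) → ℝ} {upsilon : ℝ → Fin m → ℝ}
    (h : IsInterconnection A B c β T u x zeta mu phi upsilon) :
    SolvesOn T (stateVec x zeta mu phi upsilon) fun t =>
      stateMatrix m A c β *ᵥ stateVec x zeta mu phi upsilon t + inputMatrix B *ᵥ u t := by
  have hs := h.plant.sumElim
    ((h.zeta_eq.sumElim h.mu_eq).sumElim (h.phi_eq.sumElim h.upsilon_eq))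
  have hf : ∀ t, stateMatrix m A c β *ᵥ stateVec x zeta mu phi upsilon t + inputMatrix B *ᵥ u t
      = Sum.elim (AM A *ᵥ x t + BM B *ᵥ u t) (Sum.elim
        (Sum.elim (ArKron c m *ᵥ zeta t + BrKron n m *ᵥ u t)
          (ArKron c p *ᵥ mu t + BrKron n p *ᵥ (CM n p *ᵥ x t)))
        (Sum.elim (-β • phi t + chi zeta mu t) (-β • upsilon t + u t))) := by
    intro t
    ext i
    rcases i with i | (i | i) | (i | i) | i <;>
      simp [stateMatrix, inputMatrix, stateVec, filterMatrix, chi, fromBlocks_mulVec,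
        fromRows_mulVec, smul_mulVec, neg_mulVec, add_comm]
  simp only [hf]
  exact hs

end Interconnection

/-! ### Annihilating polynomials and spectrum of the interconnection -/

section Annihilation

open Matrix Polynomial
open scoped Matrix.Norms.Operator

variable {n m p : ℕ}

/-- The channel of a filter state: its position in the filter and the signal it filters. -/
def channel : (Fin n × Fin m) ⊕ (Fin n × Fin p) → Fin n × (Fin m ⊕ Fin p) :=
  Sum.elim (fun a => (a.1, Sum.inl a.2)) (fun a => (a.1, Sum.inr a.2))

/-- The embedding of one copy of `ℝⁿ` as the states of the channel `s`. -/
def channelEmb (n : ℕ) {m p : ℕ} (s : Fin m ⊕ Fin p) :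
    Matrix ((Fin n × Fin m) ⊕ (Fin n × Fin p)) (Fin n) ℝ :=
  Matrix.of fun a i => if channel a = (i, s) then 1 else 0

/-- Each channel evolves by `A_r`. As `channelEmb s` exhausts all states when `s` varies, a
polynomial annihilating `A_r` (or its exponential) annihilates the matrix of all the filters, with
no increase of the degree. -/
theorem channelEmb_intertwine (c : Fin n → ℝ) (s : Fin m ⊕ Fin p) :
    channelEmb n s * Ar c = filterMatrix m p c * channelEmb n s := by
  ext a j
  rcases s with s | s <;> rcases a with ⟨i, b⟩ | ⟨i, b⟩ <;>
    simp [channelEmb, channel, filterMatrix, ArKron, Matrix.mul_apply, Fintype.sum_sum_type,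
      Fintype.sum_prod_type, kroneckerMap_apply, Matrix.one_apply, Prod.ext_iff, ite_and]

theorem eq_zero_of_mul_channelEmb
    {Y : Matrix ((Fin n × Fin m) ⊕ (Fin n × Fin p)) ((Fin n × Fin m) ⊕ (Fin n × Fin p)) ℝ}
    (h : ∀ s : Fin m ⊕ Fin p, Y * channelEmb n s = 0) : Y = 0 := by
  ext a a'
  rcases a' with ⟨i, b⟩ | ⟨i, b⟩
  · simpa [Matrix.mul_apply, channelEmb, channel, Fintype.sum_sum_type, Fintype.sum_prod_type,
      ite_and] using congrFun (congrFun (h (Sum.inl b)) a) i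
  · simpa [Matrix.mul_apply, channelEmb, channel, Fintype.sum_sum_type, Fintype.sum_prod_type,
      ite_and] using congrFun (congrFun (h (Sum.inr b)) a) i

theorem aeval_filterMatrix_eq_zero (c : Fin n → ℝ) :
    aeval (filterMatrix m p c) (Ar c).charpoly = 0 := by
  refine eq_zero_of_mul_channelEmb fun s => ?_
  rw [← mul_aeval_of_intertwine (channelEmb_intertwine c s), aeval_self_charpoly, Matrix.mul_zero]

theorem aeval_exp_filterMatrix_eq_zero (c : Fin n → ℝ) (T : ℝ) :
    aeval (NormedSpace.exp (T • filterMatrix m p c))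
      (NormedSpace.exp (T • (Ar c)ᵀ)).charpoly = 0 := by
  refine eq_zero_of_mul_channelEmb fun s => ?_
  rw [← transpose_smul, exp_transpose, charpoly_transpose, ← mul_aeval_of_intertwine
    (mul_exp_of_intertwine (smul_intertwine (channelEmb_intertwine c s) T)), aeval_self_charpoly,
    Matrix.mul_zero]

theorem exp_smul_smul_one {ι : Type*} [Fintype ι] [DecidableEq ι] (T b : ℝ) :
    NormedSpace.exp (T • b • (1 : Matrix ι ι ℝ)) = algebraMap ℝ _ (Real.exp (b * T)) := by
  have h := NormedSpace.algebraMap_exp_comm (𝔸 := Matrix ι ι ℝ) (b * T)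
  rw [← Real.exp_eq_exp_ℝ] at h
  rw [h, smul_smul, mul_comm T b, Algebra.algebraMap_eq_smul_one]
  rfl

/-- The polynomial `det(z - exp(A_M T)) · w(z)`, with `w` the polynomial of the FIR filter,
annihilates the sampled state matrix. -/
theorem aeval_exp_stateMatrix_eq_zero (A : Fin n → Matrix (Fin p) (Fin p) ℝ) (c : Fin n → ℝ)
    (β T : ℝ) :
    aeval (NormedSpace.exp (T • stateMatrix m A c β))
      ((NormedSpace.exp (T • AM A)).charpoly * firPoly c β T) = 0 := by
  obtain ⟨Y, hY⟩ := exists_exp_fromBlocks_lower (AM A)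
    (fromRows (fromRows (0 : Matrix (Fin n × Fin m) _ ℝ) (BrKron n p * CM n p))
      (0 : Matrix (((Fin n × Fin m) ⊕ (Fin n × Fin p)) ⊕ Fin m) _ ℝ))
    (fromBlocks (filterMatrix m p c) 0 (fromRows 1 0) (-β • 1)) T
  obtain ⟨Z, hZ⟩ := exists_exp_fromBlocks_lower (filterMatrix m p c)
    (fromRows (1 : Matrix ((Fin n × Fin m) ⊕ (Fin n × Fin p)) _ ℝ) (0 : Matrix (Fin m) _ ℝ))
    (-β • 1) T
  rw [stateMatrix, hY, hZ, firPoly, mul_comm (X - C _)]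
  refine aeval_mul_fromBlocks_lower_eq_zero _ (aeval_self_charpoly _)
    (aeval_mul_fromBlocks_lower_eq_zero _ (aeval_exp_filterMatrix_eq_zero c T) ?_)
  rw [exp_smul_smul_one]
  simp

theorem aeval_augMatrix_eq_zero (A : Fin n → Matrix (Fin p) (Fin p) ℝ)
    (B : Fin n → Matrix (Fin p) (Fin m) ℝ) (c : Fin n → ℝ) (β : ℝ) :
    aeval (augMatrix A B c β)
      (X * ((AM A).charpoly * ((Ar c).charpoly * (X - C (-β))))) = 0 := by
  refine aeval_mul_fromBlocks_lower_eq_zero _ (by simp)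
    (aeval_mul_fromBlocks_lower_eq_zero _ (aeval_self_charpoly _)
      (aeval_mul_fromBlocks_lower_eq_zero _ (aeval_filterMatrix_eq_zero c) ?_))
  simp [Algebra.algebraMap_eq_smul_one]

theorem mem_cspec_iff {ι : Type*} [Fintype ι] [DecidableEq ι] {M : Matrix ι ι ℝ} {z : ℂ} :
    z ∈ cspec M ↔ aeval z M.charpoly = 0 := by
  rw [cspec, Matrix.mem_spectrum_iff_isRoot_charpoly, Matrix.charpoly_map, IsRoot,
    eval_map_algebraMap]

theorem conj_mem_cspec {ι : Type*} [Fintype ι] [DecidableEq ι] {M : Matrix ι ι ℝ} {z : ℂ}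
    (h : z ∈ cspec M) : (starRingEnd ℂ) z ∈ cspec M := by
  rw [mem_cspec_iff] at h ⊢
  rw [aeval_conj, h, map_zero]

theorem aeval_eq_zero_of_mem_cspec {ι : Type*} [Fintype ι] [DecidableEq ι] {M : Matrix ι ι ℝ}
    {q : ℝ[X]} (hq : aeval M q = 0) {z : ℂ} (h : z ∈ cspec M) : aeval z q = 0 := by
  have hq' : aeval (M.map (algebraMap ℝ ℂ)) q = 0 := by
    have := Polynomial.aeval_algHom_apply (Algebra.ofId ℝ ℂ).mapMatrix M q
    rw [hq, map_zero] at this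
    exact this
  have h1 := spectrum.subset_polynomial_aeval (𝕜 := ℂ) (M.map (algebraMap ℝ ℂ))
    (q.map (algebraMap ℝ ℂ)) ⟨z, h, rfl⟩
  rw [aeval_map_algebraMap, hq'] at h1
  by_contra h2
  refine h1 ?_
  beta_reduce
  rw [eval_map_algebraMap, spectrum.mem_resolventSet_iff, sub_zero]
  exact (isUnit_iff_ne_zero.mpr h2).map (algebraMap ℂ (Matrix ι ι ℂ))

theorem cspec_augMatrix_subset (A : Fin n → Matrix (Fin p) (Fin p) ℝ)
    (B : Fin n → Matrix (Fin p) (Fin m) ℝ) (c : Fin n → ℝ) (β : ℝ) :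
    cspec (augMatrix A B c β) ⊆
      insert 0 ({((-β : ℝ) : ℂ)} ∪ cspec (AM A) ∪ cspec (Ar c)) := by
  intro z hz
  have h := aeval_eq_zero_of_mem_cspec (aeval_augMatrix_eq_zero A B c β) hz
  simp only [map_mul, aeval_X, mul_eq_zero, map_sub, aeval_C, ← mem_cspec_iff] at h
  simp only [Set.mem_insert_iff, Set.mem_union, Set.mem_singleton_iff]
  rcases h with h | h | h | h
  · exact Or.inl h
  · exact Or.inr (Or.inl (Or.inr h))
  · exact Or.inr (Or.inr h)
  · exact Or.inr (Or.inl (Or.inl (sub_eq_zero.mp h)))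

/-- The mode `0` of a constant input may be added to a non-pathological set closed under complex
conjugation: a mode `2πik/T` would alias with its conjugate. -/
theorem NonPathological.insert_zero {T : ℝ} (hT : T ≠ 0) {S : Set ℂ} (h : NonPathological T S)
    (hS : ∀ z ∈ S, (starRingEnd ℂ) z ∈ S) : NonPathological T (insert 0 S) := by
  have key : ∀ k : ℤ, k ≠ 0 →
      Complex.I * (2 * (k : ℂ) * (Real.pi : ℂ) * (T : ℂ)⁻¹) ∉ S := by
    intro k hk hmem
    refine h ⟨_, hS _ hmem, 2 * k, by simpa using hk, ?_⟩
    convert hmem using 1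
    simp only [map_mul, Complex.conj_I, map_inv₀, Complex.conj_ofReal, map_ofNat, map_intCast]
    push_cast
    ring
  rintro ⟨l, hl, k, hk, hlk⟩
  rcases hl with rfl | hl
  · rcases hlk with hlk | hlk
    · simp [hk, hT, Real.pi_ne_zero] at hlk
    · exact key k hk (by simpa using hlk)
  · rcases hlk with hlk | hlk
    · refine key (-k) (by simpa using hk) ?_
      rw [add_eq_zero_iff_eq_neg] at hlk
      rw [hlk] at hl
      convert hl using 1
      push_cast
      ring
    · exact h ⟨l, hl, k, hk, hlk⟩

end Annihilation

/-! ### Persistency of excitation -/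

section Excitation

open Matrix Polynomial

theorem rank_eq_card_iff {ι κ : Type*} [Fintype ι] [Fintype κ] (M : Matrix ι κ ℝ) :
    M.rank = Fintype.card ι ↔ ∀ v : ι → ℝ, v ᵥ* M = 0 → v = 0 := by
  rw [Matrix.rank_eq_finrank_span_row, eq_comm, ← Set.finrank,
    ← linearIndependent_iff_card_eq_finrank_span, ← Matrix.vecMul_injective_iff]
  exact injective_iff_map_eq_zero (Matrix.vecMulLinear M)

/-- No nontrivial linear difference equation of order less than `L` holds along a sequence that is
persistently exciting of order `L`. -/
theorem PersistentlyExciting.eq_zero {m L len : ℕ} {s : ℕ → Fin m → ℝ}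
    (h : PersistentlyExciting L len s) {r : ℕ → Fin m → ℝ}
    (hr : ∀ j, j + L ≤ len → ∑ i ∈ Finset.range L, r i ⬝ᵥ s (i + j) = 0) {i : ℕ} (hi : i < L) :
    r i = 0 := by
  have hc : (hankel L len s).rank = Fintype.card (Fin L × Fin m) := by
    rw [h]
    simp
  have hv := (rank_eq_card_iff _).mp hc (fun a => r a.1 a.2) (by
    ext j
    have hj : (j : ℕ) + L ≤ len := by have := j.2; omega
    have := hr j hj
    rw [Finset.sum_range] at this
    simpa [vecMul, dotProduct, hankel, Fintype.sum_prod_type] using this)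
  ext a
  exact congrFun hv (⟨i, hi⟩, a)

/-- The forward shift of real sequences. -/
def shift : Module.End ℝ (ℕ → ℝ) := LinearMap.funLeft ℝ ℝ Nat.succ

theorem shift_pow_apply (i : ℕ) (s : ℕ → ℝ) (j : ℕ) : (shift ^ i) s j = s (j + i) := by
  induction i generalizing j with
  | zero => simp
  | succ i ih =>
    rw [pow_succ', Module.End.mul_apply, shift, LinearMap.funLeft_apply, ← shift, ih]
    congr 1
    omega

theorem aeval_shift_apply (p : ℝ[X]) (s : ℕ → ℝ) (j : ℕ) :
    aeval shift p s j = ∑ i ∈ Finset.range (p.natDegree + 1), p.coeff i * s (j + i) := by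
  rw [aeval_eq_sum_range, LinearMap.sum_apply, Finset.sum_apply]
  simp [shift_pow_apply]

/-- A difference equation valid on a finite window implies its multiples on the shortened window. -/
theorem aeval_shift_mul_eq_zero {a q : ℝ[X]} {s : ℕ → ℝ} {lo N : ℕ}
    (h : ∀ j, lo ≤ j → j + q.natDegree ≤ N → aeval shift q s j = 0) {j : ℕ} (hlo : lo ≤ j)
    (hN : j + (a.natDegree + q.natDegree) ≤ N) : aeval shift (a * q) s j = 0 := by
  rw [map_mul, Module.End.mul_apply, aeval_shift_apply]
  refine Finset.sum_eq_zero fun i hi => ?_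
  rw [Finset.mem_range] at hi
  rw [h (j + i) (by omega) (by omega), mul_zero]

variable {ι : Type*} [Fintype ι] [DecidableEq ι] {m : ℕ}

/-- Variation of constants in discrete time. -/
theorem state_add_eq {X : ℕ → ι → ℝ} {F : Matrix ι ι ℝ} {G : Matrix ι (Fin m) ℝ}
    {d : ℕ → Fin m → ℝ} {N : ℕ} (hX : ∀ k, k < N → X (k + 1) = F *ᵥ X k + G *ᵥ d k)
    (a i : ℕ) (h : a + i ≤ N) :
    X (a + i) = F ^ i *ᵥ X a + ∑ l ∈ Finset.range i, (F ^ (i - 1 - l) * G) *ᵥ d (a + l) := by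
  induction i with
  | zero => simp
  | succ i ih =>
    rw [← add_assoc, hX _ (by omega), ih (by omega), mulVec_add, mulVec_mulVec, ← pow_succ',
      add_assoc, Finset.sum_range_succ]
    congr 2
    · rw [mulVec_sum]
      refine Finset.sum_congr rfl fun l hl => ?_
      rw [Finset.mem_range] at hl
      rw [mulVec_mulVec, ← Matrix.mul_assoc, ← pow_succ']
      congr 3
      omega
    · simp

/-- A linear functional of the state that satisfies, along a sufficiently exciting input, a
difference equation whose polynomial annihilates the state matrix, has zero impulse response. -/
theorem vecMul_pow_mul_eq_zero_of_excitation {X : ℕ → ι → ℝ} {F : Matrix ι ι ℝ}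
    {G : Matrix ι (Fin m) ℝ} {d : ℕ → Fin m → ℝ} {N L : ℕ}
    (hX : ∀ k, k < N → X (k + 1) = F *ᵥ X k + G *ᵥ d k)
    (hd : PersistentlyExciting L (N - 1) fun k => d (k + 1))
    {P : ℝ[X]} (hP : P.Monic) (hPF : aeval F P = 0) (hPL : P.natDegree ≤ L) {v : ι → ℝ}
    (hv : ∀ j, 1 ≤ j → j + P.natDegree ≤ N → aeval shift P (fun k => v ⬝ᵥ X k) j = 0) (k : ℕ) :
    v ᵥ* (F ^ k * G) = 0 := by
  set D := P.natDegree with hD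
  -- `r l` is the coefficient of the input at time `j + l` in the difference equation
  have hr := fun i => hd.eq_zero (i := i) (r := fun l => ∑ i ∈ Finset.range (D + 1),
      if l < i then P.coeff i • (v ᵥ* (F ^ (i - 1 - l) * G)) else 0) (by
    intro j hj
    rcases Nat.eq_zero_or_pos L with hL | hL
    · simp [hL]
    have h1 := hv (j + 1) (by omega) (by omega)
    rw [aeval_shift_apply] at h1
    have h2 : ∀ i ∈ Finset.range (D + 1), P.coeff i * (v ⬝ᵥ X (j + 1 + i))
        = P.coeff i * (v ⬝ᵥ (F ^ i *ᵥ X (j + 1))) + ∑ l ∈ Finset.range L,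
          (if l < i then P.coeff i • (v ᵥ* (F ^ (i - 1 - l) * G)) else 0) ⬝ᵥ d (l + j + 1) := by
      intro i hi
      rw [Finset.mem_range] at hi
      rw [state_add_eq hX (j + 1) i (by omega), dotProduct_add, mul_add, dotProduct_sum,
        Finset.mul_sum]
      congr 1
      rw [← Finset.sum_subset (Finset.range_mono (show i ≤ L by omega))]
      · refine Finset.sum_congr rfl fun l hl => ?_
        rw [if_pos (Finset.mem_range.mp hl), smul_dotProduct, ← dotProduct_mulVec, smul_eq_mul,
          show j + 1 + l = l + j + 1 by omega]
      · intro l _ hl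
        rw [if_neg (by simpa using hl), zero_dotProduct]
    rw [Finset.sum_congr rfl h2, Finset.sum_add_distrib, Finset.sum_comm] at h1
    have h3 : ∑ i ∈ Finset.range (D + 1), P.coeff i * (v ⬝ᵥ (F ^ i *ᵥ X (j + 1))) = 0 := by
      have h4 : v ⬝ᵥ (aeval F P *ᵥ X (j + 1)) = 0 := by rw [hPF]; simp
      rw [aeval_eq_sum_range, sum_mulVec, dotProduct_sum] at h4
      simpa [smul_mulVec] using h4
    rw [h3, zero_add] at h1
    simpa [sum_dotProduct] using h1)
  induction k using Nat.strong_induction_on with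
  | _ k ih =>
    rcases lt_or_ge k D with hk | hk
    · have h1 := hr (D - 1 - k) (by omega)
      rw [Finset.sum_range_succ, if_pos (by omega), hP.coeff_natDegree, one_smul,
        show D - 1 - (D - 1 - k) = k by omega, Finset.sum_eq_zero, zero_add] at h1
      · exact h1
      · intro i hi
        rw [Finset.mem_range] at hi
        split_ifs with hlt
        · rw [ih _ (by omega), smul_zero]
        · rfl
    · have h1 : v ᵥ* (aeval F P * (F ^ (k - D) * G)) = 0 := by rw [hPF]; simp
      rw [aeval_eq_sum_range, ← hD, Finset.sum_range_succ, Matrix.add_mul, Matrix.sum_mul,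
        vecMul_add, vecMul_sum, Finset.sum_eq_zero, zero_add, hP.coeff_natDegree, one_smul,
        ← Matrix.mul_assoc, ← pow_add, show D + (k - D) = k by omega] at h1
      · exact h1
      · intro i hi
        rw [Finset.mem_range] at hi
        rw [Matrix.smul_mul, vecMul_smul, ← Matrix.mul_assoc, ← pow_add, ih _ (by omega), smul_zero]

end Excitation

/-! ### Markov parameters of the plant -/

section Realization

open Matrix
open scoped Matrix.Norms.Operator

variable {n m p h : ℕ}

/-- Zero extension of a finite family of matrices. -/
def extend {ι κ : Type*} (A : Fin n → Matrix ι κ ℝ) (i : ℕ) : Matrix ι κ ℝ :=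
  if hi : i < n then A ⟨i, hi⟩ else 0

/-- `C Aᵏ + A_1 C Aᵏ⁻¹ + ⋯ + A_k C`, where `A_1, A_2, …` are the coefficients `P 0, P 1, …`. For
`k < n`, these are the block rows, from the bottom up, of the map taking the state of a realization
to the state of the block companion form. -/
def observerRow (P : ℕ → Matrix (Fin p) (Fin p) ℝ) (A : Matrix (Fin h) (Fin h) ℝ)
    (C : Matrix (Fin p) (Fin h) ℝ) (k : ℕ) : Matrix (Fin p) (Fin h) ℝ :=
  C * A ^ k + ∑ l ∈ Finset.range k, P l * C * A ^ (k - 1 - l)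

theorem observerRow_zero (P : ℕ → Matrix (Fin p) (Fin p) ℝ) (A : Matrix (Fin h) (Fin h) ℝ)
    (C : Matrix (Fin p) (Fin h) ℝ) : observerRow P A C 0 = C := by
  rw [observerRow, Finset.range_zero, Finset.sum_empty, add_zero, pow_zero, Matrix.mul_one]

theorem observerRow_succ (P : ℕ → Matrix (Fin p) (Fin p) ℝ) (A : Matrix (Fin h) (Fin h) ℝ)
    (C : Matrix (Fin p) (Fin h) ℝ) (k : ℕ) :
    observerRow P A C (k + 1) = observerRow P A C k * A + P k * C := by
  rw [observerRow, observerRow, Finset.sum_range_succ, Matrix.add_mul, Matrix.sum_mul, pow_succ,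
    ← Matrix.mul_assoc, ← add_assoc]
  congr 1
  congr 1
  · refine Finset.sum_congr rfl fun l hl => ?_
    rw [Finset.mem_range] at hl
    rw [Matrix.mul_assoc _ _ A, ← pow_succ]
    congr 2
    omega
  · rw [show k + 1 - 1 - k = 0 by omega, pow_zero, Matrix.mul_one]

theorem hasDerivAt_mulVec_exp_smul {ι κ : Type*} [Fintype ι] [DecidableEq ι] [Fintype κ]
    (K : Matrix κ ι ℝ) (G : Matrix ι ι ℝ) (w : ι → ℝ) (t : ℝ) :
    HasDerivAt (fun s : ℝ => K *ᵥ (NormedSpace.exp (s • G) *ᵥ w))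
      ((K * G) *ᵥ (NormedSpace.exp (t • G) *ᵥ w)) t := by
  have h1 := hasDerivWithinAt_mulVec (fun i j =>
    (hasDerivAt_exp_smul_entry G t i j).hasDerivWithinAt (s := Set.univ))
    (hasDerivWithinAt_const t Set.univ w)
  have h2 := hasDerivWithinAt_mulVec (E := fun _ => K) (E' := 0)
    (fun i j => hasDerivWithinAt_const t Set.univ (K i j)) h1
  have hc : Commute (NormedSpace.exp (t • G)) G := ((Commute.refl G).smul_left t).exp_left
  rw [hasDerivWithinAt_univ, hc.eq] at h2
  simpa [mulVec_mulVec, Matrix.mul_assoc] using h2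

theorem iteratedDeriv_mulVec_exp_smul {ι κ : Type*} [Fintype ι] [DecidableEq ι] [Fintype κ]
    (K : Matrix κ ι ℝ) (G : Matrix ι ι ℝ) (w : ι → ℝ) (k : ℕ) :
    iteratedDeriv k (fun t : ℝ => K *ᵥ (NormedSpace.exp (t • G) *ᵥ w))
      = fun t => (K * G ^ k) *ᵥ (NormedSpace.exp (t • G) *ᵥ w) := by
  induction k with
  | zero => simp
  | succ k ih =>
    rw [iteratedDeriv_succ, ih]
    funext t
    rw [(hasDerivAt_mulVec_exp_smul (K * G ^ k) G w t).deriv, Matrix.mul_assoc, ← pow_succ]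

theorem contDiff_mulVec_exp_smul {ι κ : Type*} [Fintype ι] [DecidableEq ι] [Fintype κ]
    (K : Matrix κ ι ℝ) (G : Matrix ι ι ℝ) (w : ι → ℝ) :
    ContDiff ℝ ∞ (fun t : ℝ => K *ᵥ (NormedSpace.exp (t • G) *ᵥ w)) := by
  refine contDiff_of_differentiable_iteratedDeriv fun k _ => ?_
  rw [iteratedDeriv_mulVec_exp_smul]
  exact fun t => (hasDerivAt_mulVec_exp_smul _ G w t).differentiableAt

/-- The plant driven by an input with `u' = l u`. -/
theorem pow_exosystem_mulVec (A : Matrix (Fin h) (Fin h) ℝ) (B : Matrix (Fin h) (Fin m) ℝ) (l : ℝ)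
    (x : Fin h → ℝ) (u : Fin m → ℝ) (k : ℕ) :
    fromBlocks A B 0 (l • (1 : Matrix (Fin m) (Fin m) ℝ)) ^ k *ᵥ Sum.elim x u
      = Sum.elim (A ^ k *ᵥ x + ∑ i ∈ Finset.range k, l ^ i • ((A ^ (k - 1 - i) * B) *ᵥ u))
        (l ^ k • u) := by
  induction k with
  | zero => simp
  | succ k ih =>
    rw [pow_succ', ← mulVec_mulVec, ih, fromBlocks_mulVec]
    congr 1
    · rw [Sum.elim_comp_inl, Sum.elim_comp_inr, mulVec_add, mulVec_mulVec, ← pow_succ', mulVec_sum,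
        Finset.sum_range_succ, add_assoc]
      congr 2
      · refine Finset.sum_congr rfl fun i hi => ?_
        rw [Finset.mem_range] at hi
        rw [mulVec_smul, mulVec_mulVec, ← Matrix.mul_assoc, ← pow_succ']
        congr 4
        omega
      · simp [mulVec_smul]
    · simp [smul_mulVec, smul_smul, pow_succ']

/-- The differential equation at time `0`, along the trajectory with initial state `x` and input
`exp (l t) u`. -/
theorem IsRealization.exponential_response {Abar : Matrix (Fin h) (Fin h) ℝ}
    {Bbar : Matrix (Fin h) (Fin m) ℝ} {Cbar : Matrix (Fin p) (Fin h) ℝ}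
    {A : Fin n → Matrix (Fin p) (Fin p) ℝ} {B : Fin n → Matrix (Fin p) (Fin m) ℝ}
    (hr : IsRealization Abar Bbar Cbar A B) (l : ℝ) (x : Fin h → ℝ) (u : Fin m → ℝ) :
    observerRow (extend A) Abar Cbar n *ᵥ x
      + ∑ i ∈ Finset.range n,
        l ^ i • ((observerRow (extend A) Abar Cbar (n - 1 - i) * Bbar) *ᵥ u)
      = ∑ i ∈ Finset.range n, l ^ i • (extend B (n - 1 - i) *ᵥ u) := by
  set G := fromBlocks Abar Bbar 0 (l • (1 : Matrix (Fin m) (Fin m) ℝ)) with hG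
  set w : Fin h ⊕ Fin m → ℝ := Sum.elim x u with hw
  set Kx : Matrix (Fin h) (Fin h ⊕ Fin m) ℝ := fromCols 1 0 with hKx
  set Ku : Matrix (Fin m) (Fin h ⊕ Fin m) ℝ := fromCols 0 1 with hKu
  have hx : Kx * G = Abar * Kx + Bbar * Ku := by
    simp only [hKx, hKu, hG, fromCols_mul_fromBlocks, mul_fromCols]
    ext i (j | j) <;> simp
  have h1 := hr (fun t => Ku *ᵥ (NormedSpace.exp (t • G) *ᵥ w))
    (fun t => Kx *ᵥ (NormedSpace.exp (t • G) *ᵥ w)) (contDiff_mulVec_exp_smul _ _ _) (fun t => by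
      have h2 := hasDerivAt_mulVec_exp_smul Kx G w t
      rwa [hx, add_mulVec, ← mulVec_mulVec, ← mulVec_mulVec] at h2) 0
  have hy : (fun s : ℝ => Cbar *ᵥ (Kx *ᵥ (NormedSpace.exp (s • G) *ᵥ w)))
      = fun s => (Cbar * Kx) *ᵥ (NormedSpace.exp (s • G) *ᵥ w) := by
    funext s
    rw [mulVec_mulVec]
  have hKxw : ∀ k, (Cbar * Kx * G ^ k) *ᵥ w = (Cbar * Abar ^ k) *ᵥ x
      + ∑ i ∈ Finset.range k, l ^ i • ((Cbar * Abar ^ (k - 1 - i) * Bbar) *ᵥ u) := by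
    intro k
    rw [← mulVec_mulVec, hG, hw, pow_exosystem_mulVec, ← mulVec_mulVec, hKx, fromCols_mulVec]
    simp [mulVec_add, mulVec_sum, mulVec_smul, mulVec_mulVec, Matrix.mul_assoc]
  have hKuw : ∀ k, (Ku * G ^ k) *ᵥ w = l ^ k • u := by
    intro k
    rw [← mulVec_mulVec, hG, hw, pow_exosystem_mulVec, hKu, fromCols_mulVec]
    simp
  simp only [DiffEqAt, hy, iteratedDeriv_mulVec_exp_smul, zero_smul, NormedSpace.exp_zero,
    one_mulVec, hKxw, hKuw] at h1
  have hA : ∀ f : ℕ → Fin p → ℝ, ∑ i : Fin n, A i *ᵥ f (n - (i + 1))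
      = ∑ i ∈ Finset.range n, extend A i *ᵥ f (n - 1 - i) := by
    intro f
    rw [Finset.sum_range]
    refine Finset.sum_congr rfl fun i _ => ?_
    rw [extend, dif_pos i.2, show n - ((i : ℕ) + 1) = n - 1 - i by omega]
  have hB : ∑ i : Fin n, B i *ᵥ (l ^ (n - ((i : ℕ) + 1)) • u)
      = ∑ i ∈ Finset.range n, l ^ i • (extend B (n - 1 - i) *ᵥ u) := by
    rw [← Finset.sum_range_reflect, Finset.sum_range]
    refine Finset.sum_congr rfl fun i _ => ?_
    have hi := i.2
    rw [show n - 1 - (n - 1 - (i : ℕ)) = i by omega, extend, dif_pos i.2, mulVec_smul,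
      show n - ((i : ℕ) + 1) = n - 1 - i by omega]
  rw [hB, hA (fun k => (Cbar * Abar ^ k) *ᵥ x
    + ∑ i ∈ Finset.range k, l ^ i • ((Cbar * Abar ^ (k - 1 - i) * Bbar) *ᵥ u))] at h1
  rw [← h1]
  simp only [observerRow, add_mulVec, sum_mulVec, Matrix.add_mul, Matrix.sum_mul, mulVec_add,
    mulVec_sum, smul_add, Finset.sum_add_distrib, Finset.smul_sum, mulVec_smul, mulVec_mulVec,
    Matrix.mul_assoc]
  rw [add_add_add_comm]
  congr 2
  rw [Finset.sum_comm' (t' := Finset.range n) (s' := fun i => Finset.range (n - 1 - i))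
    (fun i j => by simp only [Finset.mem_range]; omega)]
  refine Finset.sum_congr rfl fun i _ => Finset.sum_congr rfl fun j _ => ?_
  rw [show n - 1 - j - 1 - i = n - 1 - i - 1 - j by omega]

theorem eq_zero_of_sum_pow_smul_eq_zero {ι : Type*} {N : ℕ} {f : ℕ → ι → ℝ}
    (hf : ∀ l : ℝ, ∑ i ∈ Finset.range N, l ^ i • f i = 0) {i : ℕ} (hi : i < N) : f i = 0 := by
  ext a
  have hq : ∑ i ∈ Finset.range N, Polynomial.C (f i a) * Polynomial.X ^ i = 0 := by
    refine Polynomial.funext fun l => ?_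
    have := congrFun (hf l) a
    rw [Polynomial.eval_finsetSum, Polynomial.eval_zero]
    simpa [Finset.sum_apply, mul_comm (_ ^ _ : ℝ)] using this
  have := congrArg (fun q => Polynomial.coeff q i) hq
  simpa [Polynomial.finsetSum_coeff, Polynomial.coeff_X_pow, hi] using this

/-- The free response satisfies the homogeneous differential equation. -/
theorem IsRealization.observerRow_eq_zero {Abar : Matrix (Fin h) (Fin h) ℝ}
    {Bbar : Matrix (Fin h) (Fin m) ℝ} {Cbar : Matrix (Fin p) (Fin h) ℝ}
    {A : Fin n → Matrix (Fin p) (Fin p) ℝ} {B : Fin n → Matrix (Fin p) (Fin m) ℝ}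
    (hr : IsRealization Abar Bbar Cbar A B) : observerRow (extend A) Abar Cbar n = 0 := by
  refine ext_of_mulVec_single fun i => ?_
  rw [zero_mulVec]
  simpa only [mulVec_zero, smul_zero, Finset.sum_const_zero, add_zero] using
    hr.exponential_response 0 (Pi.single i 1) 0

/-- Comparison of the coefficients of `l ^ (n - 1 - i)` in `IsRealization.exponential_response`. -/
theorem IsRealization.observerRow_mul {Abar : Matrix (Fin h) (Fin h) ℝ}
    {Bbar : Matrix (Fin h) (Fin m) ℝ} {Cbar : Matrix (Fin p) (Fin h) ℝ}
    {A : Fin n → Matrix (Fin p) (Fin p) ℝ} {B : Fin n → Matrix (Fin p) (Fin m) ℝ}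
    (hr : IsRealization Abar Bbar Cbar A B) (i : Fin n) :
    observerRow (extend A) Abar Cbar i * Bbar = B i := by
  refine ext_of_mulVec_single fun a => ?_
  have hi := i.2
  have h1 := eq_zero_of_sum_pow_smul_eq_zero (N := n) (i := n - 1 - i)
    (f := fun k => (observerRow (extend A) Abar Cbar (n - 1 - k) * Bbar) *ᵥ Pi.single a 1
      - extend B (n - 1 - k) *ᵥ Pi.single a 1) (fun l => by
      have h2 := hr.exponential_response l 0 (Pi.single a 1)
      rw [mulVec_zero, zero_add] at h2
      simp only [smul_sub, Finset.sum_sub_distrib]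
      rw [h2, sub_self]) (by omega)
  rw [show n - 1 - (n - 1 - (i : ℕ)) = i by omega, sub_eq_zero, extend, dif_pos hi] at h1
  exact h1

/-- The map from the state of a realization to the state of the block companion form; its rows are
the matrices `observerRow`, from the bottom up. -/
def observerMap (A : Fin n → Matrix (Fin p) (Fin p) ℝ) (Abar : Matrix (Fin h) (Fin h) ℝ)
    (Cbar : Matrix (Fin p) (Fin h) ℝ) : Matrix (Fin n × Fin p) (Fin h) ℝ :=
  Matrix.of fun i j => observerRow (extend A) Abar Cbar i.1.rev i.2 j

theorem CM_mul_observerMap (hn : 1 ≤ n) (A : Fin n → Matrix (Fin p) (Fin p) ℝ)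
    (Abar : Matrix (Fin h) (Fin h) ℝ) (Cbar : Matrix (Fin p) (Fin h) ℝ) :
    CM n p * observerMap A Abar Cbar = Cbar := by
  obtain ⟨k, rfl⟩ := Nat.exists_eq_add_of_le' hn
  have hlast : ∀ i : Fin (k + 1), (i : ℕ) = k ↔ i = Fin.last k := fun i => by
    simp [Fin.ext_iff]
  ext i j
  simp [CM, observerMap, Matrix.mul_apply, Fintype.sum_prod_type, ite_and, hlast, observerRow_zero]

theorem IsRealization.observerMap_mul {Abar : Matrix (Fin h) (Fin h) ℝ}
    {Bbar : Matrix (Fin h) (Fin m) ℝ} {Cbar : Matrix (Fin p) (Fin h) ℝ}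
    {A : Fin n → Matrix (Fin p) (Fin p) ℝ} {B : Fin n → Matrix (Fin p) (Fin m) ℝ}
    (hr : IsRealization Abar Bbar Cbar A B) : observerMap A Abar Cbar * Bbar = BM B := by
  ext i j
  have := congrFun (congrFun (hr.observerRow_mul i.1.rev) i.2) j
  simpa [observerMap, BM, Matrix.mul_apply] using this

theorem IsRealization.observerMap_intertwine {Abar : Matrix (Fin h) (Fin h) ℝ}
    {Bbar : Matrix (Fin h) (Fin m) ℝ} {Cbar : Matrix (Fin p) (Fin h) ℝ}
    {A : Fin n → Matrix (Fin p) (Fin p) ℝ} {B : Fin n → Matrix (Fin p) (Fin m) ℝ} (hn : 1 ≤ n)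
    (hr : IsRealization Abar Bbar Cbar A B) :
    observerMap A Abar Cbar * Abar = AM A * observerMap A Abar Cbar := by
  obtain ⟨k, rfl⟩ := Nat.exists_eq_add_of_le' hn
  have hlast : ∀ i : Fin (k + 1), (i : ℕ) = k ↔ i = Fin.last k := fun i => by
    simp [Fin.ext_iff]
  ext ⟨i, a⟩ j
  have h1 := observerRow_succ (extend A) Abar Cbar i.rev
  have h2 : extend A i.rev = A i.rev := dif_pos i.rev.2
  rw [h2, ← sub_eq_iff_eq_add] at h1
  have h3 : (observerMap A Abar Cbar * Abar) (i, a) j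
      = observerRow (extend A) Abar Cbar (i.rev + 1) a j - ∑ b, A i.rev a b * Cbar b j := by
    rw [← Matrix.mul_apply, ← Matrix.sub_apply, h1]
    simp [observerMap, Matrix.mul_apply]
  have h4 : ∀ b : Fin p, observerMap A Abar Cbar (Fin.last k, b) j = Cbar b j := fun b => by
    simp [observerMap, observerRow_zero]
  rw [h3]
  simp only [Matrix.mul_apply, Fintype.sum_prod_type, Fin.sum_univ_castSucc, h4]
  have h5 : ∀ b, AM A (i, a) (Fin.last k, b) = -(A i.rev a b) := fun b => by simp [AM]
  have h6 : ∀ (i' : Fin k) b, AM A (i, a) (i'.castSucc, b)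
      = if i = i'.succ ∧ a = b then 1 else 0 := fun i' b => by
    have := i'.2
    simp [AM, Fin.ext_iff, this.ne]
  simp only [h5, h6, neg_mul, Finset.sum_neg_distrib]
  rw [← sub_eq_add_neg]
  congr 1
  clear h1 h2 h3 h4 h5 h6
  refine Fin.cases ?_ (fun i' => ?_) i
  · have := hr.observerRow_eq_zero
    simp [Fin.rev, this, (Fin.succ_ne_zero _).symm]
  · simp [ite_and, observerMap, Fin.rev]
    rw [show k - ((i' : ℕ) + 1) + 1 = k - i' by have := i'.2; omega]

/-- The block companion form and every realization have the same Markov parameters. -/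
theorem IsRealization.markov_eq {Abar : Matrix (Fin h) (Fin h) ℝ}
    {Bbar : Matrix (Fin h) (Fin m) ℝ} {Cbar : Matrix (Fin p) (Fin h) ℝ}
    {A : Fin n → Matrix (Fin p) (Fin p) ℝ} {B : Fin n → Matrix (Fin p) (Fin m) ℝ} (hn : 1 ≤ n)
    (hr : IsRealization Abar Bbar Cbar A B) (k : ℕ) :
    CM n p * (AM A ^ k * BM B) = Cbar * (Abar ^ k * Bbar) := by
  rw [← hr.observerMap_mul, ← Matrix.mul_assoc (AM A ^ k),
    ← mul_pow_of_intertwine (hr.observerMap_intertwine hn), ← Matrix.mul_assoc, ← Matrix.mul_assoc,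
    CM_mul_observerMap hn, Matrix.mul_assoc]

end Realization

/-! ### Injectivity of the impulse response -/

section ImpulseResponse

open Matrix
open scoped Matrix.Norms.Operator

variable {n m p h : ℕ}

/-- The difference operator with characteristic polynomial `zⁿ + c_1 zⁿ⁻¹ + ⋯ + c_n`. -/
def companionOp (c : Fin n → ℝ) : Module.End ℝ (ℕ → ℝ) :=
  shift ^ n + ∑ l : Fin n, c l.rev • shift ^ (l : ℕ)

theorem companionOp_commute (c : Fin n → ℝ) (i : ℕ) : Commute (companionOp c) (shift ^ i) :=
  (Commute.pow_pow_self _ _ _).add_left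
    (Commute.sum_left _ _ _ fun _ _ => (Commute.pow_pow_self _ _ _).smul_left _)

/-- In a companion system, every state is a shift of the state at position `0`. -/
theorem companion_state_eq_shift {k : ℕ} {c : Fin (k + 1) → ℝ} {S : Fin (k + 1) → ℕ → ℝ}
    {g : ℕ → ℝ}
    (hS : ∀ i j, S i (j + 1) = ∑ l, Ar c i l * S l j + if (i : ℕ) = k then g j else 0)
    (i : Fin (k + 1)) : S i = (shift ^ (i : ℕ)) (S 0) := by
  funext j
  rw [shift_pow_apply]
  induction i using Fin.induction generalizing j with
  | zero => simp
  | succ i ih =>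
    have hi := i.2
    have h1 := hS i.castSucc j
    have h2 : ∀ l : Fin (k + 1), Ar c i.castSucc l = if l = i.succ then 1 else 0 := fun l => by
      simp [Ar, hi.ne, Fin.ext_iff]
    simp only [h2, ite_mul, one_mul, zero_mul, Finset.sum_ite_eq', Finset.mem_univ, if_true,
      Fin.val_castSucc, if_neg hi.ne, add_zero] at h1
    rw [← h1, ih]
    congr 1
    simp
    omega

/-- In a companion system, the state at position `0` solves the difference equation. -/
theorem companionOp_apply_state {k : ℕ} {c : Fin (k + 1) → ℝ} {S : Fin (k + 1) → ℕ → ℝ}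
    {g : ℕ → ℝ}
    (hS : ∀ i j, S i (j + 1) = ∑ l, Ar c i l * S l j + if (i : ℕ) = k then g j else 0) :
    companionOp c (S 0) = g := by
  funext j
  have h1 := hS (Fin.last k) j
  have h2 : ∀ l : Fin (k + 1), Ar c (Fin.last k) l = -(c l.rev) := fun l => by simp [Ar]
  have h3 : ∀ l : Fin (k + 1), (shift ^ (l : ℕ)) (S 0) j = S l j := fun l =>
    congrFun (companion_state_eq_shift hS l).symm j
  have h4 : (shift ^ (k + 1)) (S 0) j = S (Fin.last k) (j + 1) := by
    rw [companion_state_eq_shift hS (Fin.last k), shift_pow_apply, shift_pow_apply]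
    congr 1
    simp
    omega
  simp only [companionOp, LinearMap.add_apply, LinearMap.sum_apply, LinearMap.smul_apply,
    Pi.add_apply, Finset.sum_apply, Pi.smul_apply, smul_eq_mul, h3, h4, h1, h2, Fin.val_last,
    if_true]
  simp

/-- By reachability the relation says that `α` annihilates the first `n` blocks of the
observability matrix, which is square and of full rank. -/
theorem PlantAssumption.eq_zero_of_markov {Abar : Matrix (Fin h) (Fin h) ℝ}
    {Bbar : Matrix (Fin h) (Fin m) ℝ} {Cbar : Matrix (Fin p) (Fin h) ℝ}
    (hplant : PlantAssumption n Abar Bbar Cbar) {α : Fin n × Fin p → ℝ}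
    (hα : ∀ j b, ∑ a, α a * (Cbar * (Abar ^ (j + (a.1 : ℕ)) * Bbar)) a.2 b = 0) : α = 0 := by
  have hobs : (obsMatrix n Abar Cbar).rank = Fintype.card (Fin n × Fin p) := by
    rw [hplant.rank_obs, ← hplant.dim]
    simp [mul_comm]
  refine (rank_eq_card_iff _).mp hobs α ?_
  have hreach : (reachMatrix h Abar Bbar).rank = Fintype.card (Fin h) := by
    rw [hplant.reachable]
    simp
  refine (rank_eq_card_iff _).mp hreach _ ?_
  rw [vecMul_vecMul]
  ext ⟨j, b⟩
  rw [Pi.zero_apply, ← hα j b]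
  refine Finset.sum_congr rfl fun a _ => ?_
  congr 1
  have h1 : Cbar * (Abar ^ ((j : ℕ) + (a.1 : ℕ)) * Bbar)
      = (Cbar * Abar ^ (a.1 : ℕ)) * (Abar ^ (j : ℕ) * Bbar) := by
    rw [add_comm, pow_add]
    simp only [Matrix.mul_assoc]
  rw [h1]
  rfl

/-- The impulse responses of the states of the filters `col(ζ, μ)` are linearly independent. -/
theorem eq_zero_of_vecMul_filter_response (hn : 1 ≤ n) {Abar : Matrix (Fin h) (Fin h) ℝ}
    {Bbar : Matrix (Fin h) (Fin m) ℝ} {Cbar : Matrix (Fin p) (Fin h) ℝ}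
    (hplant : PlantAssumption n Abar Bbar Cbar) {c : Fin n → ℝ}
    {Y : ℕ → Matrix ((Fin n × Fin m) ⊕ (Fin n × Fin p)) (Fin m) ℝ}
    (hY0 : Y 0 = fromRows (BrKron n m) 0)
    (hY : ∀ j, Y (j + 1) = filterMatrix m p c * Y j
      + fromRows 0 (BrKron n p * (Cbar * (Abar ^ j * Bbar))))
    {η : (Fin n × Fin m) ⊕ (Fin n × Fin p) → ℝ} (hη : ∀ j, η ᵥ* Y j = 0) : η = 0 := by
  obtain ⟨k, rfl⟩ := Nat.exists_eq_add_of_le' hn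
  have hu : ∀ (b a : Fin m) (i : Fin (k + 1)) (j : ℕ), Y (j + 1) (Sum.inl (i, a)) b
      = ∑ l, Ar c i l * Y j (Sum.inl (l, a)) b + if (i : ℕ) = k then (0 : ℕ → ℝ) j else 0 := by
    intro b a i j
    simp [hY, Matrix.mul_apply, filterMatrix, ArKron, Fintype.sum_sum_type,
      Fintype.sum_prod_type, kroneckerMap_apply, Matrix.one_apply]
  have hy : ∀ (b : Fin m) (a : Fin p) (i : Fin (k + 1)) (j : ℕ), Y (j + 1) (Sum.inr (i, a)) b
      = ∑ l, Ar c i l * Y j (Sum.inr (l, a)) b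
        + if (i : ℕ) = k then (Cbar * (Abar ^ j * Bbar)) a b else 0 := by
    intro b a i j
    rw [hY, Matrix.add_apply, fromRows_apply_inr, Matrix.mul_apply, Matrix.mul_apply]
    simp [filterMatrix, ArKron, BrKron, Br, Fintype.sum_sum_type,
      Fintype.sum_prod_type, kroneckerMap_apply, Matrix.one_apply]
  -- the relation between the impulse responses, as an identity of sequences
  have hrel : ∀ b : Fin m, ∑ a : Fin (k + 1) × Fin m, η (Sum.inl a) •
        (shift ^ (a.1 : ℕ)) (fun j => Y j (Sum.inl (0, a.2)) b)
      + ∑ a : Fin (k + 1) × Fin p, η (Sum.inr a) •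
        (shift ^ (a.1 : ℕ)) (fun j => Y j (Sum.inr (0, a.2)) b) = 0 := by
    intro b
    funext j
    have h1 := congrFun (hη j) b
    rw [vecMul, dotProduct, Fintype.sum_sum_type] at h1
    simp only [Pi.add_apply, Finset.sum_apply, Pi.smul_apply, smul_eq_mul]
    rw [Pi.zero_apply] at h1 ⊢
    rw [← h1]
    congr 1
    · refine Finset.sum_congr rfl fun a _ => ?_
      rw [← companion_state_eq_shift (S := fun i j => Y j (Sum.inl (i, a.2)) b) (hu b a.2) a.1]
    · refine Finset.sum_congr rfl fun a _ => ?_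
      rw [← companion_state_eq_shift (S := fun i j => Y j (Sum.inr (i, a.2)) b)
        (g := fun j => (Cbar * (Abar ^ j * Bbar)) a.2 b) (hy b a.2) a.1]
  have hα : (fun a => η (Sum.inr a)) = 0 := by
    refine hplant.eq_zero_of_markov fun j b => ?_
    have h1 := congrFun (congrArg (companionOp c) (hrel b)) j
    have hcomm : ∀ (i : ℕ) (s : ℕ → ℝ),
        companionOp c ((shift ^ i) s) = (shift ^ i) (companionOp c s) := fun i s => by
      rw [← Module.End.mul_apply, (companionOp_commute c i).eq, Module.End.mul_apply]
    have h2 : ∀ a : Fin m, companionOp c (fun j => Y j (Sum.inl (0, a)) b) = 0 := fun a =>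
      companionOp_apply_state (S := fun i j => Y j (Sum.inl (i, a)) b) (hu b a)
    have h3 : ∀ a : Fin p, companionOp c (fun j => Y j (Sum.inr (0, a)) b)
        = fun j => (Cbar * (Abar ^ j * Bbar)) a b := fun a =>
      companionOp_apply_state (S := fun i j => Y j (Sum.inr (i, a)) b) (hy b a)
    simp only [map_add, map_sum, map_smul, hcomm, h2, h3, map_zero, smul_zero,
      Finset.sum_const_zero, zero_add, Finset.sum_apply, Pi.smul_apply, shift_pow_apply,
      smul_eq_mul, Pi.zero_apply] at h1
    exact h1
  have hα' : ∀ a, η (Sum.inr a) = 0 := fun a => congrFun hα a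
  have he : ∀ (b a : Fin m) (j : ℕ), j < k + 1 →
      Y j (Sum.inl (0, a)) b = if j = k ∧ a = b then 1 else 0 := by
    intro b a j hj
    have h1 := congrFun (companion_state_eq_shift (S := fun i j => Y j (Sum.inl (i, a)) b)
      (hu b a) ⟨j, hj⟩) 0
    rw [shift_pow_apply, zero_add] at h1
    rw [← h1, hY0]
    simp [BrKron, Br, kroneckerMap_apply, Matrix.one_apply, ← ite_and, and_comm]
  have hγ : ∀ (r : ℕ) (i : Fin (k + 1)) (b : Fin m), (i : ℕ) + r = k → η (Sum.inl (i, b)) = 0 := by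
    intro r
    induction r using Nat.strong_induction_on with
    | _ r ih =>
      intro i b hir
      have h1 := congrFun (hrel b) r
      simp only [hα', zero_smul, Finset.sum_const_zero, add_zero, Finset.sum_apply, Pi.smul_apply,
        shift_pow_apply, smul_eq_mul, Pi.zero_apply] at h1
      rw [Finset.sum_eq_single (i, b), he _ _ _ (by simp only; omega),
        if_pos ⟨by simp only; omega, rfl⟩, mul_one] at h1
      · exact h1
      · rintro ⟨i', b'⟩ - hne
        have hi' := i'.2
        rcases lt_or_ge (i : ℕ) i' with hlt | hge
        · rw [ih (k - i') (by omega) i' b' (by omega), zero_mul]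
        · rw [he _ _ _ (by simp; omega), if_neg, mul_zero]
          rintro ⟨e1, e2⟩
          exact hne (Prod.ext (Fin.ext (by simp at e1 ⊢; omega)) e2)
      · simp
  ext (⟨i, b⟩ | a)
  · exact hγ (k - i) i b (by have := i.2; omega)
  · exact hα' a

/-- The coordinates `(φ, υ)` of the state respond to the input with linearly independent impulse
responses. -/
theorem eq_zero_of_vecMul_impulse_response (hn : 1 ≤ n) {Abar : Matrix (Fin h) (Fin h) ℝ}
    {Bbar : Matrix (Fin h) (Fin m) ℝ} {Cbar : Matrix (Fin p) (Fin h) ℝ}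
    {A : Fin n → Matrix (Fin p) (Fin p) ℝ} {B : Fin n → Matrix (Fin p) (Fin m) ℝ}
    (hplant : PlantAssumption n Abar Bbar Cbar) (hreal : IsRealization Abar Bbar Cbar A B)
    {c : Fin n → ℝ} {β : ℝ} {v : ((Fin n × Fin m) ⊕ (Fin n × Fin p)) ⊕ Fin m → ℝ}
    (hv : ∀ j : ℕ, (Sum.elim 0 (Sum.elim 0 v) : StateIdx n m p → ℝ) ᵥ*
      (stateMatrix m A c β ^ j * inputMatrix B) = 0) : v = 0 := by
  set W : ℕ → Matrix (StateIdx n m p) (Fin m) ℝ :=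
    fun j => stateMatrix m A c β ^ j * inputMatrix B with hW
  have hW0 : W 0 = inputMatrix B := by simp [hW]
  have hWs : ∀ j, W (j + 1) = stateMatrix m A c β * W j := fun j => by
    simp only [hW]
    rw [pow_succ', Matrix.mul_assoc]
  set Y := fun j => (W j).toRows₂.toRows₁ with hY
  set Z := fun j => (W j).toRows₂.toRows₂ with hZ
  have hsplit : ∀ j, W j = fromRows (W j).toRows₁ (fromRows (Y j) (Z j)) := fun j => by
    simp [hY, hZ]
  have hstep : ∀ j, fromRows (W (j + 1)).toRows₁ (fromRows (Y (j + 1)) (Z (j + 1)))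
      = fromRows (AM A * (W j).toRows₁)
        (fromRows (filterMatrix m p c * Y j
          + fromRows 0 (BrKron n p * (CM n p * (W j).toRows₁)))
          (fromRows (Y j) 0 - β • Z j)) := fun j => by
    rw [← hsplit (j + 1), hWs, hsplit j, stateMatrix, fromBlocks_mul_fromRows,
      fromBlocks_mul_fromRows, fromRows_mul, fromRows_mul, fromRows_mul]
    ext (i | i | i) b <;> simp [Matrix.mul_assoc]
    · exact add_comm _ _
    · exact (sub_eq_add_neg _ _).symm
  have hX : ∀ j, (W j).toRows₁ = AM A ^ j * BM B := by
    intro j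
    induction j with
    | zero => simp [hW0, inputMatrix]
    | succ j ih => rw [(fromRows_inj (hstep j)).1, ih, pow_succ', Matrix.mul_assoc]
  have hvZ : ∀ j, v ᵥ* Z j = 0 := fun j => by
    have h1 := hv j
    change _ ᵥ* W j = 0 at h1
    rw [hsplit j] at h1
    simpa [vecMul_fromRows] using h1
  have hZ0 : Z 0 = fromRows 0 1 := by simp [hZ, hW0, inputMatrix]
  have hξ : v ∘ Sum.inr = 0 := by
    have h1 := hvZ 0
    rw [hZ0, vecMul_fromRows] at h1
    simpa using h1
  have hη : v ∘ Sum.inl = 0 := by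
    refine eq_zero_of_vecMul_filter_response hn hplant (c := c) (Y := Y) ?_ ?_ ?_
    · simp [hY, hW0, inputMatrix]
    · intro j
      rw [(fromRows_inj (fromRows_inj (hstep j)).2).1, hX, hreal.markov_eq hn]
    · intro j
      have h1 := hvZ (j + 1)
      rw [(fromRows_inj (fromRows_inj (hstep j)).2).2, vecMul_sub, vecMul_smul, hvZ,
        vecMul_fromRows] at h1
      simpa using h1
  ext (i | i)
  · exact congrFun hη i
  · exact congrFun hξ i

/-- The discrete-time impulse response of the sampled interconnection determines that of the
continuous-time one. -/
theorem vecMul_impulse_response_of_sampled {A : Fin n → Matrix (Fin p) (Fin p) ℝ}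
    {B : Fin n → Matrix (Fin p) (Fin m) ℝ} {c : Fin n → ℝ} {β T : ℝ} (hT : T ≠ 0)
    (hS : NonPathological T (cspec (augMatrix A B c β)))
    {F : Matrix (StateIdx n m p) (StateIdx n m p) ℝ}
    {Γ : Matrix (StateIdx n m p) (Fin m) ℝ}
    (hexp : NormedSpace.exp (T • augMatrix A B c β) = fromBlocks 1 0 Γ F)
    {g : StateIdx n m p → ℝ} (hg : ∀ k : ℕ, g ᵥ* (F ^ k * Γ) = 0) (j : ℕ) :
    g ᵥ* (stateMatrix m A c β ^ j * inputMatrix B) = 0 := by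
  ext b
  set w : Fin m → ℝ := Pi.single b 1 with hw
  have hd : ∀ i : ℕ, ∃ y, fromBlocks 1 0 Γ F ^ i *ᵥ Sum.elim w 0 = Sum.elim w y ∧
      ∀ k : ℕ, g ⬝ᵥ (F ^ k *ᵥ y) = 0 := by
    intro i
    induction i with
    | zero => exact ⟨0, by simp, by simp⟩
    | succ i ih =>
      obtain ⟨y, h1, h2⟩ := ih
      refine ⟨Γ *ᵥ w + F *ᵥ y, ?_, fun k => ?_⟩
      · rw [pow_succ', ← mulVec_mulVec, h1, fromBlocks_mulVec]
        simp
      · rw [mulVec_add, dotProduct_add, mulVec_mulVec, mulVec_mulVec, ← pow_succ, h2,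
          dotProduct_mulVec, hg, zero_dotProduct, add_zero]
  have hc := dotProduct_pow_mulVec_eq_zero_of_sampled hT hS (Sum.elim 0 g) (Sum.elim w 0)
    (fun i => by
      obtain ⟨y, h1, h2⟩ := hd i
      have h3 := h2 0
      rw [hexp, h1, sumElim_dotProduct_sumElim, zero_dotProduct, zero_add]
      simpa using h3) (j + 1)
  have hpow : ∀ i : ℕ, augMatrix A B c β ^ (i + 1) *ᵥ Sum.elim w 0
      = Sum.elim (0 : Fin m → ℝ) ((stateMatrix m A c β ^ i * inputMatrix B) *ᵥ w) := by
    intro i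
    induction i with
    | zero => simp [augMatrix, fromBlocks_mulVec]
    | succ i ih =>
      rw [pow_succ', ← mulVec_mulVec, ih, augMatrix, fromBlocks_mulVec]
      simp [mulVec_mulVec, pow_succ', Matrix.mul_assoc]
  rw [hpow, sumElim_dotProduct_sumElim, zero_dotProduct, zero_add, dotProduct_mulVec] at hc
  simpa [hw] using hc

end ImpulseResponse

/-! ### The filtered data matrix -/

section DataMatrix

open Matrix Polynomial
open scoped Matrix.Norms.Operator

theorem firPoly_monic {n : ℕ} (c : Fin n → ℝ) (β T : ℝ) : (firPoly c β T).Monic :=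
  (monic_X_sub_C _).mul (charpoly_monic _)

theorem natDegree_firPoly {n : ℕ} (c : Fin n → ℝ) (β T : ℝ) :
    (firPoly c β T).natDegree = n + 1 := by
  rw [firPoly, (monic_X_sub_C _).natDegree_mul (charpoly_monic _), charpoly_natDegree_eq_dim,
    natDegree_X_sub_C, Fintype.card_fin, add_comm]

/-- Multiplication by the Toeplitz matrix `WN` applies the FIR filter to a row of samples
`s 1, …, s N`. -/
theorem vecMul_WN_apply {n N : ℕ} (c : Fin n → ℝ) (β T : ℝ) (s : ℕ → ℝ) (j : Fin (N - n - 1)) :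
    ((fun i : Fin N => s (i + 1)) ᵥ* WN c β T N) j = aeval shift (firPoly c β T) s (j + 1) := by
  have hj := j.2
  rw [aeval_shift_apply, natDegree_firPoly]
  simp only [vecMul, dotProduct, WN, of_apply, mul_ite, mul_zero]
  rw [← Finset.sum_range fun i => if (j : ℕ) ≤ i ∧ i - j ≤ n + 1
      then s (i + 1) * firCoeff c β T (n + 1 - (i - j)) else 0,
    ← Finset.sum_subset (s₁ := Finset.Ico (j : ℕ) (j + (n + 2))), Finset.sum_Ico_eq_sum_range]
  · rw [Nat.add_sub_cancel_left]
    refine Finset.sum_congr rfl fun i hi => ?_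
    rw [Finset.mem_range] at hi
    rw [if_pos (by omega), firCoeff, mul_comm]
    congr 2 <;> omega
  · intro i hi
    rw [Finset.mem_Ico] at hi
    rw [Finset.mem_range]
    omega
  · intro i _ hi
    rw [Finset.mem_Ico] at hi
    rw [if_neg (by omega)]

end DataMatrix

end MIMOExcitation

open MIMOExcitation Matrix Polynomial

theorem proposition1 {n m p h N : ℕ} (hn : 1 ≤ n) (hm : 1 ≤ m) (hp : 1 ≤ p)
    (Abar : Matrix (Fin h) (Fin h) ℝ) (Bbar : Matrix (Fin h) (Fin m) ℝ)
    (Cbar : Matrix (Fin p) (Fin h) ℝ)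
    (A : Fin n → Matrix (Fin p) (Fin p) ℝ) (B : Fin n → Matrix (Fin p) (Fin m) ℝ)
    (hplant : MIMOExcitation.PlantAssumption n Abar Bbar Cbar)
    (hreal : MIMOExcitation.IsRealization Abar Bbar Cbar A B)
    (c : Fin n → ℝ) (β : ℝ)
    (hβ : ((-β : ℝ) : ℂ) ∉ MIMOExcitation.cspec (MIMOExcitation.Ar c))
    (hdisj : MIMOExcitation.cspec (MIMOExcitation.AM A) ∩
      MIMOExcitation.cspec (MIMOExcitation.Ar c) = ∅)
    (TS : ℝ) (hTS : 0 < TS)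
    (hpath : MIMOExcitation.NonPathological TS
      ({((-β : ℝ) : ℂ)} ∪ MIMOExcitation.cspec (MIMOExcitation.AM A) ∪
        MIMOExcitation.cspec (MIMOExcitation.Ar c)))
    (d : ℕ → Fin m → ℝ) (u : ℝ → Fin m → ℝ)
    (hu : ∀ k < N, ∀ t ∈ Set.Ico ((k : ℝ) * TS) (((k : ℝ) + 1) * TS), u t = d k)
    (x : ℝ → Fin n × Fin p → ℝ) (zeta : ℝ → Fin n × Fin m → ℝ) (mu : ℝ → Fin n × Fin p → ℝ)
    (phi : ℝ → (Fin n × Fin m) ⊕ (Fin n × Fin p) → ℝ) (upsilon : ℝ → Fin m → ℝ)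
    (htraj : MIMOExcitation.IsInterconnection A B c β ((N : ℝ) * TS) u x zeta mu phi upsilon)
    (hpe : MIMOExcitation.PersistentlyExciting (2 * ((m + p) * n + m)) (N - 1)
      (fun k => d (k + 1))) :
    (Matrix.fromRows
      (MIMOExcitation.dataMatrix N TS phi * MIMOExcitation.WN c β TS N)
      (MIMOExcitation.dataMatrix N TS upsilon * MIMOExcitation.WN c β TS N)).rank
      = (m + p) * n + m := by
  have hT0 : TS ≠ 0 := hTS.ne'
  set X : ℕ → StateIdx n m p → ℝ := fun k => stateVec x zeta mu phi upsilon (k * TS) with hX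
  obtain ⟨Γ, hΓ⟩ := exists_exp_fromBlocks_lower (0 : Matrix (Fin m) (Fin m) ℝ) (inputMatrix B)
    (stateMatrix m A c β) TS
  rw [smul_zero, NormedSpace.exp_zero] at hΓ
  set F := NormedSpace.exp (TS • stateMatrix m A c β) with hF
  have hstep : ∀ k, k < N → X (k + 1) = F *ᵥ X k + Γ *ᵥ d k := by
    intro k hk
    have hkN : ((k : ℝ) + 1) * TS ≤ N * TS :=
      mul_le_mul_of_nonneg_right (by exact_mod_cast hk) hTS.le
    have h1 := htraj.solvesOn.sample (a := k * TS) (b := (k + 1) * TS) (by positivity)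
      (by nlinarith) hkN (hu k hk)
    rw [show ((k : ℝ) + 1) * TS - k * TS = TS by ring, hΓ, fromBlocks_mulVec] at h1
    have h2 := congrArg (fun f => f ∘ Sum.inr) h1
    simp only [Sum.elim_comp_inr, Sum.elim_comp_inl] at h2
    simp only [hX, Nat.cast_add, Nat.cast_one]
    rw [h2, add_comm]
  -- the held input only adds the mode `0`
  have hS : NonPathological TS (cspec (augMatrix A B c β)) := by
    have h1 := hpath.insert_zero hT0 (by
      rintro z ((hz | hz) | hz)
      · rw [Set.mem_singleton_iff] at hz
        exact Or.inl (Or.inl (by simp [hz]))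
      · exact Or.inl (Or.inr (conj_mem_cspec hz))
      · exact Or.inr (conj_mem_cspec hz))
    rintro ⟨l, hl, k, hk, hlk⟩
    exact h1 ⟨l, cspec_augMatrix_subset A B c β hl, k, hk, cspec_augMatrix_subset A B c β hlk⟩
  have hcard : (m + p) * n + m
      = Fintype.card (((Fin n × Fin m) ⊕ (Fin n × Fin p)) ⊕ Fin m) := by
    simp
    ring
  rw [hcard, rank_eq_card_iff]
  intro v hv
  -- `v` annihilates the filtered data; `g` is `v` as a functional of the whole state
  set g : StateIdx n m p → ℝ := Sum.elim 0 (Sum.elim 0 v) with hg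
  set s : ℕ → ℝ := fun k => g ⬝ᵥ X k with hs
  have hgX : ∀ k, s k = (v ∘ Sum.inl) ⬝ᵥ phi (k * TS) + (v ∘ Sum.inr) ⬝ᵥ upsilon (k * TS) := by
    intro k
    simp [hs, hg, hX, stateVec, dotProduct, Fintype.sum_sum_type]
  have hfir : ∀ j, 1 ≤ j → j + (firPoly c β TS).natDegree ≤ N →
      aeval shift (firPoly c β TS) s j = 0 := by
    intro j hj hjN
    rw [natDegree_firPoly] at hjN
    have h1 := vecMul_WN_apply c β TS s (N := N) ⟨j - 1, by omega⟩
    simp only [Nat.sub_add_cancel hj] at h1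
    rw [← h1]
    rw [← fromRows_mul, ← vecMul_vecMul] at hv
    have h2 : v ᵥ* fromRows (dataMatrix N TS phi) (dataMatrix N TS upsilon)
        = fun i : Fin N => s (i + 1) := by
      ext i
      rw [hgX, vecMul_fromRows]
      simp [vecMul, dataMatrix, dotProduct]
    rw [h2] at hv
    exact congrFun hv _
  have hmarkov : ∀ k : ℕ, g ᵥ* (F ^ k * Γ) = 0 := by
    set a := (NormedSpace.exp (TS • AM A)).charpoly with ha
    have hadeg : a.natDegree = n * p := by
      rw [ha, charpoly_natDegree_eq_dim]
      simp
    have hdeg : (a * firPoly c β TS).natDegree = a.natDegree + (firPoly c β TS).natDegree :=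
      (charpoly_monic _).natDegree_mul (firPoly_monic c β TS)
    refine vecMul_pow_mul_eq_zero_of_excitation hstep hpe
      (P := a * firPoly c β TS) ((charpoly_monic _).mul (firPoly_monic c β TS))
      (aeval_exp_stateMatrix_eq_zero A c β TS) ?_ ?_
    · -- the order of the difference equation is `n p + n + 1`
      rw [hdeg, hadeg, natDegree_firPoly]
      have h1 : n * p ≤ (m + p) * n := by nlinarith
      have h2 : n ≤ (m + p) * n := by nlinarith
      omega
    · intro j hj hjN
      rw [hdeg] at hjN
      exact aeval_shift_mul_eq_zero hfir hj hjN
  exact eq_zero_of_vecMul_impulse_response hn hplant hreal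
    (vecMul_impulse_response_of_sampled hT0 hS hΓ hmarkov)
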